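/- Let $n\ge 2$ and let $\mathbb H^n=\{x\in\mathbb R^n: x_n>0\}$ be the upper half-space model of hyperbolic space, with metric $ds^2_{\mathrm{hyp}}=(dx_1^2+\dots+dx_n^2)/x_n^2$. Let $M$ be a connected smooth $n$-manifold, and let $F:M\to\mathbb H^n\times\mathbb R$ be a smooth spacelike immersion into the Lorentzian product with metric $ds^2_{\mathrm{hyp}}-dt^2$, that is, the induced metric on $M$ is positive definite. Suppose that $M$ has constant mean curvature $H\in\mathbb R$ with respect to its future-pointing unit normal: whenever $M$ is written locally as a level set $\{f=0\}$ of a smooth function with timelike gradient and $\partial f/\partial t>0$, one has $$nH=-\operatorname{div}\frac{\nabla f}{|\nabla f|}\quad\text{on } M,\qquad |\nabla f|=\sqrt{-\langle\nabla f,\nabla f\rangle},$$ where $\nabla$ and $\operatorname{div}$ are taken with respect to the Lorentzian metric. Suppose moreover that $M$ is foliated by spheres lying in horizontal slices: $M$ carries a smooth foliation of codimension one, each leaf of which is mapped by $F$ bijectively onto a hyperbolic sphere of positive radius in some slice $\mathbb H^n\times\{t\}$. Suppose finally that $F(M)$ is not contained in a single slice. If $H\neq 0$, or if $H=0$ and $n\ge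 3$, then $M$ is rotationally symmetric. That is, there is a point $c\in\mathbb H^n$ such that the hyperbolic center of every leaf lies on the vertical geodesic $\{c\}\times\mathbb R$; in particular, $F(M)$ is invariant under $g\times\mathrm{id}_{\mathbb R}$ for every isometry $g$ of $\mathbb H^n$ fixing $c$. -/

import Mathlib

open scoped Manifold ContDiff

noncomputable section

namespace LorentzProduct

/-- The coordinate space `ℝⁿ × ℝ` of points `(x, t)`. The Lorentzian product `ℍⁿ × ℝ` is its open
subset `{xₙ > 0}`, with the metric `lorentzMetric` below. -/
abbrev Amb (n : ℕ) : Type := EuclideanSpace ℝ (Fin n) × ℝ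

/-- The upper half-space `{x ∈ ℝⁿ : xₙ > 0}`; `⊤ : Fin n` is the index of the last coordinate. -/
def upperHalf (n : ℕ) [NeZero n] : Set (EuclideanSpace ℝ (Fin n)) := {x | 0 < x ⊤}

/-- Hyperbolic distance in the upper half-space model (the metric `|dx|² / xₙ²`);
the same formula as Mathlib's distance on `UpperHalfPlane`. -/
def hypDist {n : ℕ} [NeZero n] (x y : EuclideanSpace ℝ (Fin n)) : ℝ :=
  2 * Real.arsinh (‖x - y‖ / (2 * √(x ⊤ * y ⊤)))

/-- The hyperbolic sphere of center `c` and radius `R` in the horizontal slice `ℍⁿ × {t}`. -/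
def horizontalSphere {n : ℕ} [NeZero n] (c : EuclideanSpace ℝ (Fin n)) (R t : ℝ) : Set (Amb n) :=
  {y | y.1 ∈ upperHalf n ∧ hypDist y.1 c = R ∧ y.2 = t}

/-- The Lorentzian metric `(dx₁² + ⋯ + dxₙ²) / xₙ² - dt²` at the point `y`. -/
def lorentzMetric {n : ℕ} [NeZero n] (y v w : Amb n) : ℝ :=
  inner ℝ v.1 w.1 / (y.1 ⊤) ^ 2 - v.2 * w.2

/-- `∂f/∂xᵢ`. -/
def partialX {n : ℕ} (i : Fin n) (f : Amb n → ℝ) (y : Amb n) : ℝ :=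
  fderiv ℝ f y (EuclideanSpace.single i 1, 0)

/-- `∂f/∂t`. -/
def partialT {n : ℕ} (f : Amb n → ℝ) (y : Amb n) : ℝ :=
  fderiv ℝ f y (0, 1)

/-- The gradient of `f` with respect to the Lorentzian metric, in coordinates `g^{ij} ∂ᵢf`. -/
def lorentzGrad {n : ℕ} [NeZero n] (f : Amb n → ℝ) (y : Amb n) : Amb n :=
  (WithLp.toLp 2 fun i => (y.1 ⊤) ^ 2 * partialX i f y, -partialT f y)

/-- The defining property of the gradient: `⟨∇f, v⟩ = df(v)`. -/
theorem lorentzMetric_lorentzGrad {n : ℕ} [NeZero n] (f : Amb n → ℝ) (y v : Amb n)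
    (hy : y.1 ∈ upperHalf n) : lorentzMetric y (lorentzGrad f y) v = fderiv ℝ f y v := by
  have hy0 : (y.1 ⊤) ^ 2 ≠ 0 := pow_ne_zero _ (ne_of_gt hy)
  have hv : v = (∑ i, v.1 i • ((EuclideanSpace.single i (1 : ℝ), 0) : Amb n))
      + v.2 • ((0, 1) : Amb n) := by
    refine Prod.ext ?_ ?_
    · ext j
      simp [Prod.fst_sum, Finset.sum_apply, Pi.single_apply]
    · simp [Prod.snd_sum]
  conv_rhs => rw [hv]
  simp only [map_add, map_sum, map_smul, smul_eq_mul]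
  simp only [lorentzMetric, lorentzGrad, partialX, partialT, PiLp.inner_apply, RCLike.inner_apply,
    conj_trivial]
  rw [Finset.sum_div, sub_eq_add_neg]
  congr 1
  · refine Finset.sum_congr rfl fun i _ => ?_
    rw [div_eq_iff hy0]
    ring
  · ring

/-- The volume density `√|det g| = xₙ⁻ⁿ`. -/
def volDensity {n : ℕ} [NeZero n] (y : Amb n) : ℝ := ((y.1 ⊤) ^ n)⁻¹

/-- The divergence `|g|^{-1/2} ∑ⱼ ∂ⱼ(|g|^{1/2} Zʲ)` of a vector field with respect to the
Lorentzian metric. -/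
def lorentzDiv {n : ℕ} [NeZero n] (Z : Amb n → Amb n) (y : Amb n) : ℝ :=
  (volDensity y)⁻¹ *
    (∑ i, partialX i (fun z => volDensity z * (Z z).1 i) y
      + partialT (fun z => volDensity z * (Z z).2) y)

/-- The field `∇f / |∇f|` with `|∇f| = √(-⟨∇f, ∇f⟩)`, for `∇f` timelike. -/
def unitGrad {n : ℕ} [NeZero n] (f : Amb n → ℝ) (y : Amb n) : Amb n :=
  (√(-lorentzMetric y (lorentzGrad f y) (lorentzGrad f y)))⁻¹ • lorentzGrad f y

section Hypersurface

variable {n : ℕ} [NeZero n] {M : Type*} [TopologicalSpace M]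
  [ChartedSpace (EuclideanSpace ℝ (Fin n)) M]

/-- A smooth map `F : M → ℍⁿ × ℝ` from an `n`-manifold whose induced metric is positive definite
(in particular `F` is an immersion). -/
structure IsSpacelikeHypersurface (F : M → Amb n) : Prop where
  mem_upperHalf : ∀ p, (F p).1 ∈ upperHalf n
  smooth : ContMDiff (𝓡 n) 𝓘(ℝ, Amb n) ∞ F
  posDef : ∀ (p : M) (v : TangentSpace (𝓡 n) p), v ≠ 0 →
    0 < lorentzMetric (F p) (mfderiv (𝓡 n) 𝓘(ℝ, Amb n) F p v : Amb n)
      (mfderiv (𝓡 n) 𝓘(ℝ, Amb n) F p v : Amb n)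

/-- `f` is smooth near `F p`, it vanishes on the hypersurface near `p`, and `∇f` is timelike at
`F p`; so near `p` the (immersed) hypersurface is the level set `{f = 0}`. The sign of `f` is
chosen with `∂f/∂t > 0`, that is, the unit normal `N = -∇f / |∇f|` is future-pointing. -/
structure IsLocalDefiningFunction (F : M → Amb n) (p : M) (f : Amb n → ℝ) : Prop where
  smooth : ContDiffAt ℝ ∞ f (F p)
  vanishes : ∀ᶠ q in nhds p, f (F q) = 0
  timelike : lorentzMetric (F p) (lorentzGrad f (F p)) (lorentzGrad f (F p)) < 0
  future : 0 < partialT f (F p)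

/-- The mean curvature at `p` with respect to the future-pointing unit normal is `H`:
`nH = -div (∇f / |∇f|)` at `F p`, when the hypersurface is written near `p` as a level set of `f`
(the value does not depend on `f`). -/
def HasMeanCurvatureAt (F : M → Amb n) (p : M) (H : ℝ) : Prop :=
  (∃ f, IsLocalDefiningFunction F p f) ∧
    ∀ f, IsLocalDefiningFunction F p f → n * H = -lorentzDiv (unitGrad f) (F p)

/-- The leaf through `p`: its equivalence class. -/
def leaf {M : Type*} (𝓕 : Setoid M) (p : M) : Set M := {q | 𝓕 q p}

/-- The partition of `M` into the classes of `𝓕` is a smooth foliation of codimension one (locally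
the leaves are the level sets of a real-valued submersion `u`), and `F` maps every leaf bijectively
onto a hyperbolic sphere lying in a horizontal slice. -/
structure IsHorizontalSphereFoliation (F : M → Amb n) (𝓕 : Setoid M) : Prop where
  submersion : ∀ p : M, ∃ (U : Set M) (u : M → ℝ), IsOpen U ∧ p ∈ U ∧
    ContMDiffOn (𝓡 n) 𝓘(ℝ, ℝ) ∞ u U ∧
    (∀ q ∈ U, mfderiv (𝓡 n) 𝓘(ℝ, ℝ) u q ≠ 0) ∧
    ∀ q ∈ U, ∀ q' ∈ U, (𝓕 q q' ↔ u q = u q')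
  sphere : ∀ p : M, ∃ c ∈ upperHalf n, ∃ R > 0, ∃ t : ℝ,
    Set.BijOn F (leaf 𝓕 p) (horizontalSphere c R t)

end Hypersurface

/-- A map of the upper half-space onto itself that preserves the hyperbolic distance
and fixes `c`: a rotation (or reflection) of `ℍⁿ` about `c`. -/
structure IsHypIsometryFixing {n : ℕ} [NeZero n] (c : EuclideanSpace ℝ (Fin n))
    (g : EuclideanSpace ℝ (Fin n) → EuclideanSpace ℝ (Fin n)) : Prop where
  bijOn : Set.BijOn g (upperHalf n) (upperHalf n)
  isometry : ∀ x ∈ upperHalf n, ∀ y ∈ upperHalf n, hypDist (g x) (g y) = hypDist x y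
  fixes : g c = c

/-- The set `S ⊆ ℍⁿ × ℝ` is invariant under all rotations about the vertical geodesic
`{c} × ℝ`. -/
def IsRotationallySymmetric {n : ℕ} [NeZero n] (c : EuclideanSpace ℝ (Fin n))
    (S : Set (Amb n)) : Prop :=
  ∀ g, IsHypIsometryFixing c g → (fun y : Amb n => ((g y.1, y.2) : Amb n)) '' S = S

end LorentzProduct

end

open scoped Manifold ContDiff

noncomputable section

namespace LorentzProduct

open Filter Topology

/-! Since M is spacelike, its horizontal projection is a local diffeomorphism, and M is locally a
graph t = φ(x) whose leaves are level sets {v = s}. Hyperbolic spheres are Euclidean spheres; let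
a(s), ρ(s), τ(s) be the Euclidean center, squared radius and height of a leaf, so that ρ < aₙ². With
y = xₙ and L the `lapse`, the squared mean curvature equation (`mean_curvature_eq`) has the form
(nH)² (L² - τ'²ρy²)³ = y² (k₁yL + k₂L² + k₃y² + k₄yQ)², where the kᵢ depend only on s, and y, L, Q
are affine in x on each leaf.

Along a circle of the leaf centered at a, the functions y, L, Q are affine in (cos θ, sin θ), so the
identity, known for small real θ, continues to all complex θ. At a complex zero of y it forces L =
0: directly if H ≠ 0; if H = 0, the bracket must vanish identically and leaves k₂L² = 0 with k₂ =
-(n-2)aₙτ', which is where n ≥ 3 and τ' ≠ 0 enter. Because ρ < aₙ², these zeros are not real, and a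
single one already makes L proportional to y (`affine_proportional_of_complex_zeros`). Varying the
circle gives aₙa' = (ρ'/2)eₙ (`center_deriv_eq`): the numbers aᵢ, i ≠ n, and aₙ² - ρ are locally
constant in s, and they determine the hyperbolic center.

If H = 0, the slope τ' solves a linear differential equation, so where it vanishes the height is
locally constant. The points near which the height is constant then form a clopen set, which is
empty because M is connected and not in a slice. Hence the center is locally constant on M, and so
constant. -/

/-! ### Complex zeros of affine functions of (cos θ, sin θ) -/

/-- An entire function vanishing at all small real numbers vanishes identically. -/
theorem entire_eq_zero_of_eventually_real {f : ℂ → ℂ} (hf : Differentiable ℂ f)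
    (h : ∀ᶠ θ : ℝ in 𝓝 0, f θ = 0) (z : ℂ) : f z = 0 := by
  have ha : AnalyticOnNhd ℂ f Set.univ := fun z _ => hf.analyticAt z
  have h0 : AnalyticOnNhd ℂ (fun _ : ℂ => (0 : ℂ)) Set.univ := fun z _ => analyticAt_const
  have ht : Tendsto (fun θ : ℝ => (θ : ℂ)) (𝓝[≠] 0) (𝓝[≠] 0) := by
    refine tendsto_nhdsWithin_iff.2 ⟨?_, ?_⟩
    · have := Complex.continuous_ofReal.tendsto 0
      simp only [Complex.ofReal_zero] at this
      exact this.mono_left nhdsWithin_le_nhds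
    · filter_upwards [self_mem_nhdsWithin] with θ hθ
      simpa using hθ
  have hfr : ∃ᶠ z in 𝓝[≠] (0 : ℂ), f z = 0 :=
    ht.frequently (h.filter_mono nhdsWithin_le_nhds).frequently
  exact congrFun (ha.eq_of_frequently_eq h0 hfr) z

/-- If an affine function of `(cos θ, sin θ)` vanishes at the non-real zeros of another one,
then the two are proportional. -/
theorem affine_proportional_of_complex_zeros {a b d l₀ l₁ l₂ : ℝ}
    (hbd : 0 < b ^ 2 + d ^ 2) (hlt : b ^ 2 + d ^ 2 < a ^ 2)
    (h : ∀ θ : ℂ, (a : ℂ) + b * Complex.cos θ + d * Complex.sin θ = 0 →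
      (l₀ : ℂ) + l₁ * Complex.cos θ + l₂ * Complex.sin θ = 0) :
    a * l₁ = l₀ * b ∧ a * l₂ = l₀ * d := by
  set M : ℝ := b ^ 2 + d ^ 2 with hM
  set κ : ℝ := √(a ^ 2 - M) with hκ
  have hκ0 : 0 < κ := Real.sqrt_pos.2 (by linarith)
  have hκ2 : κ ^ 2 = a ^ 2 - M := Real.sq_sqrt (by linarith)
  -- The complex cosine is onto, and the cosine fixes the sine up to sign; passing to -θ corrects
  -- the sign.
  have key : ∀ C S : ℂ, C ^ 2 + S ^ 2 = 1 → ∃ θ, Complex.cos θ = C ∧ Complex.sin θ = S := by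
    intro C S hCS
    obtain ⟨θ, hθ⟩ := Complex.cos_surjective C
    have h1 := Complex.sin_sq_add_cos_sq θ
    have h2 : (Complex.sin θ - S) * (Complex.sin θ + S) = 0 := by
      rw [hθ] at h1
      linear_combination h1 - hCS
    rcases mul_eq_zero.1 h2 with h3 | h3
    · exact ⟨θ, hθ, by linear_combination h3⟩
    · exact ⟨-θ, by rw [Complex.cos_neg, hθ], by rw [Complex.sin_neg]; linear_combination -h3⟩
  have hM0 : (M : ℂ) ≠ 0 := by exact_mod_cast hbd.ne'
  have hMc : (M : ℂ) = (b : ℂ) ^ 2 + (d : ℂ) ^ 2 := by rw [hM]; push_cast; ring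
  have hκc : (κ : ℂ) ^ 2 = (a : ℂ) ^ 2 - M := by exact_mod_cast hκ2
  -- The line a + bC + dS = 0 meets the complex circle C² + S² = 1 at (C, S) = -(a/M)(b, d) +
  -- (iκ/M)(-d, b), which is not real since κ > 0.
  obtain ⟨θ, hc, hs⟩ := key (-(a * b) / M - Complex.I * κ * d / M)
    (-(a * d) / M + Complex.I * κ * b / M) (by
      field_simp
      have hI := Complex.I_sq
      linear_combination (a ^ 2 + Complex.I ^ 2 * κ ^ 2 : ℂ) * (-hMc) + (κ : ℂ) ^ 2 * M * hI - M * hκc)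
  have hz := h θ (by
    rw [hc, hs]
    field_simp
    linear_combination (a : ℂ) * hMc)
  rw [hc, hs] at hz
  field_simp at hz
  -- All coefficients are real, so one complex equation gives two real ones: M l₀ = a(l₁b + l₂d) and
  -- κ(l₂b - l₁d) = 0.
  have hre := congrArg Complex.re hz
  have him := congrArg Complex.im hz
  simp at hre him
  have h1 : l₂ * b = l₁ * d := by
    have : κ * (l₂ * b - l₁ * d) = 0 := by linear_combination him
    rcases mul_eq_zero.1 this with h | h
    · exact absurd h hκ0.ne'
    · linarith
  constructor
  · have : M * (a * l₁ - l₀ * b) = 0 := by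
      rw [hM] at hre ⊢
      linear_combination (-b) * hre - a * d * h1
    rcases mul_eq_zero.1 this with h | h
    · exact absurd h hbd.ne'
    · linarith
  · have : M * (a * l₂ - l₀ * d) = 0 := by
      rw [hM] at hre ⊢
      linear_combination (-d) * hre + a * b * h1
    rcases mul_eq_zero.1 this with h | h
    · exact absurd h hbd.ne'
    · linarith

/-- The form in which the squared mean curvature equation is used: y divides the right-hand side, so
a complex zero of y must be a zero of L. -/
theorem affine_proportional_of_cubic {a b d l₀ l₁ l₂ q₀ q₁ q₂ K m k₁ k₂ k₃ k₄ : ℝ}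
    (hbd : 0 < b ^ 2 + d ^ 2) (hlt : b ^ 2 + d ^ 2 < a ^ 2) (hK : K ≠ 0 ∨ (K = 0 ∧ k₂ ≠ 0))
    (h : ∀ᶠ θ : ℝ in 𝓝 0, ∀ y L Q : ℝ, y = a + b * Real.cos θ + d * Real.sin θ →
      L = l₀ + l₁ * Real.cos θ + l₂ * Real.sin θ → Q = q₀ + q₁ * Real.cos θ + q₂ * Real.sin θ →
      y ≠ 0 ∧ K * (L ^ 2 - m * y ^ 2) ^ 3
        = y ^ 2 * (k₁ * (y * L) + k₂ * L ^ 2 + k₃ * y ^ 2 + k₄ * (y * Q)) ^ 2) :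
    a * l₁ = l₀ * b ∧ a * l₂ = l₀ * d := by
  refine affine_proportional_of_complex_zeros hbd hlt fun z hz => ?_
  let y : ℂ → ℂ := fun z => a + b * Complex.cos z + d * Complex.sin z
  let L : ℂ → ℂ := fun z => l₀ + l₁ * Complex.cos z + l₂ * Complex.sin z
  let Q : ℂ → ℂ := fun z => q₀ + q₁ * Complex.cos z + q₂ * Complex.sin z
  have hyd : Differentiable ℂ y := by fun_prop
  have hLd : Differentiable ℂ L := by fun_prop
  have hQd : Differentiable ℂ Q := by fun_prop
  change y z = 0 at hz
  change L z = 0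
  rcases hK with hK | ⟨hK, hk⟩
  · have := entire_eq_zero_of_eventually_real (f := fun z => K * (L z ^ 2 - m * y z ^ 2) ^ 3
        - y z ^ 2 * (k₁ * (y z * L z) + k₂ * L z ^ 2 + k₃ * y z ^ 2 + k₄ * (y z * Q z)) ^ 2)
        (by fun_prop) (by
          filter_upwards [h] with θ hθ
          have := (hθ _ _ _ rfl rfl rfl).2
          simp only [y, L, Q]
          rw [sub_eq_zero]
          exact_mod_cast this) z
    simp only [hz] at this
    have hL : (K : ℂ) * L z ^ 6 = 0 := by linear_combination this
    simpa [hK] using hL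
  -- With K = 0 the identity says nothing at a zero of y. For real θ, however, y ≠ 0, so y² and the
  -- square can be removed before continuing analytically.
  · have := entire_eq_zero_of_eventually_real
        (f := fun z => k₁ * (y z * L z) + k₂ * L z ^ 2 + k₃ * y z ^ 2 + k₄ * (y z * Q z))
        (by fun_prop) (by
          filter_upwards [h] with θ hθ
          obtain ⟨h1, h2⟩ := hθ _ _ _ rfl rfl rfl
          rw [hK, zero_mul] at h2
          have h3 := pow_eq_zero_iff (two_ne_zero) |>.1
            ((mul_eq_zero.1 h2.symm).resolve_left (pow_ne_zero 2 h1))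
          simp only [y, L, Q]
          exact_mod_cast h3) z
    simp only [hz] at this
    have hL : (k₂ : ℂ) * L z ^ 2 = 0 := by linear_combination this
    simpa [hk] using hL

/-! ### Linear algebra of the last coordinate -/

section

variable {n : ℕ} [NeZero n]

theorem inner_single_top (x : EuclideanSpace ℝ (Fin n)) :
    inner ℝ x (EuclideanSpace.single ⊤ 1) = x ⊤ := by
  simp [EuclideanSpace.inner_single_right]

/-- Bessel's inequality for the last coordinate. -/
theorem top_sq_add_top_sq_le {X η : EuclideanSpace ℝ (Fin n)} {ρ : ℝ} (hρ : 0 < ρ)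
    (hX : inner ℝ X X = ρ) (hη : inner ℝ η η = ρ) (hXη : inner ℝ X η = 0) :
    X ⊤ ^ 2 + η ⊤ ^ 2 ≤ ρ := by
  set e : EuclideanSpace ℝ (Fin n) := EuclideanSpace.single ⊤ 1
  have he : inner ℝ e e = (1 : ℝ) := by rw [inner_single_top]; simp [e]
  have hXe : inner ℝ X e = X ⊤ := inner_single_top X
  have hηe : inner ℝ η e = η ⊤ := inner_single_top η
  have hηX : inner ℝ η X = 0 := by rw [real_inner_comm]; exact hXη
  have heX : inner ℝ e X = X ⊤ := by rw [real_inner_comm]; exact hXe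
  have heη : inner ℝ e η = η ⊤ := by rw [real_inner_comm]; exact hηe
  -- This vector is ρ times the component of e orthogonal to X and η.
  have h := real_inner_self_nonneg (x := ρ • e - X ⊤ • X - η ⊤ • η)
  simp only [inner_sub_left, inner_sub_right, inner_smul_left, inner_smul_right, he, hXe, hηe, hηX,
    heX, heη, hX, hη, hXη, conj_trivial] at h
  have : 0 ≤ ρ * (ρ - (X ⊤ ^ 2 + η ⊤ ^ 2)) := by linarith
  have := nonneg_of_mul_nonneg_right this hρ
  linarith

/-- The circle spanned by X and ζ is informative only if the last coordinate is not constant on it,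
whence the side condition. If Xₙ ≠ 0, every ζ is admissible, and ζ = ξ itself can be tested once ξ ⊥
X is known. If Xₙ = 0, testing eₙ and eₙ + ξ suffices. -/
theorem eq_zero_of_orthogonal_top {X ξ : EuclideanSpace ℝ (Fin n)} (hn : 2 ≤ n)
    (h : ∀ ζ : EuclideanSpace ℝ (Fin n), ζ ≠ 0 → inner ℝ X ζ = 0 → (X ⊤ ≠ 0 ∨ ζ ⊤ ≠ 0) →
      inner ℝ X ξ = 0 ∧ inner ℝ ζ ξ = 0) : ξ = 0 := by
  by_contra hξ
  by_cases hX : X ⊤ = 0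
  · set e : EuclideanSpace ℝ (Fin n) := EuclideanSpace.single ⊤ 1 with he_def
    have he : e ⊤ = 1 := by simp [e]
    have he0 : e ≠ 0 := fun h0 => by rw [h0] at he; simp at he
    obtain ⟨h1, h2⟩ := h e he0 (by rw [inner_single_top, hX])
      (Or.inr (by rw [he]; exact one_ne_zero))
    have hξt : ξ ⊤ = 0 := by rw [← inner_single_top, real_inner_comm]; exact h2
    have het : (e + ξ) ⊤ = 1 := by simp [he, hξt]
    obtain ⟨-, h3⟩ := h (e + ξ) (fun h0 => by rw [h0] at het; simp at het)
      (by rw [inner_add_right, inner_single_top, hX, h1, add_zero])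
      (Or.inr (by rw [het]; exact one_ne_zero))
    rw [inner_add_left, h2, zero_add] at h3
    exact hξ (inner_self_eq_zero.1 h3)
  · have : Nontrivial (Fin n) := Fin.nontrivial_iff_two_le.2 hn
    obtain ⟨i, hi⟩ := exists_ne (⊤ : Fin n)
    let ζ : EuclideanSpace ℝ (Fin n) :=
      X ⊤ • EuclideanSpace.single i 1 - X i • EuclideanSpace.single ⊤ 1
    have hζi : ζ i = X ⊤ := by simp [ζ, hi]
    obtain ⟨h1, -⟩ := h ζ (fun h0 => by rw [h0] at hζi; exact hX (by simpa using hζi.symm))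
      (by simp [ζ, inner_sub_right, inner_smul_right, EuclideanSpace.inner_single_right]; ring)
      (Or.inl hX)
    exact hξ (inner_self_eq_zero.1 (h ξ hξ h1 (Or.inl hX)).2)

end

/-! ### Smooth dependence of the centers on the level -/

section

/-- The coordinate gradient of `v`. -/
def coordGrad {n : ℕ} (v : EuclideanSpace ℝ (Fin n) → ℝ) (x : EuclideanSpace ℝ (Fin n)) :
    EuclideanSpace ℝ (Fin n) :=
  WithLp.toLp 2 fun i => fderiv ℝ v x (EuclideanSpace.single i 1)

theorem inner_toLp_apply_single {n : ℕ} (f : EuclideanSpace ℝ (Fin n) →L[ℝ] ℝ)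
    (z : EuclideanSpace ℝ (Fin n)) :
    inner ℝ (WithLp.toLp 2 fun i => f (EuclideanSpace.single i 1)) z = f z := by
  have hz : z = ∑ i, z i • (EuclideanSpace.single i (1 : ℝ)) := by
    ext j
    simp [Finset.sum_apply, Pi.single_apply]
  conv_rhs => rw [hz]
  simp [PiLp.inner_apply, map_sum]

theorem inner_coordGrad {n : ℕ} (v : EuclideanSpace ℝ (Fin n) → ℝ)
    (x z : EuclideanSpace ℝ (Fin n)) : inner ℝ (coordGrad v x) z = fderiv ℝ v x z :=
  inner_toLp_apply_single _ _

theorem contDiffAt_coordGrad {n : ℕ} {v : EuclideanSpace ℝ (Fin n) → ℝ}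
    {x : EuclideanSpace ℝ (Fin n)} (hv : ContDiffAt ℝ ∞ v x) : ContDiffAt ℝ ∞ (coordGrad v) x := by
  have h : ContDiffAt ℝ ∞ (fderiv ℝ v) x := hv.fderiv_right (m := ∞) (by simp)
  rw [contDiffAt_euclidean]
  intro i
  exact h.clm_apply contDiffAt_const

section

variable {E : Type*} [NormedAddCommGroup E] [InnerProductSpace ℝ E] [CompleteSpace E]

/-- If the level set of `v` through `x` lies on a sphere centered at `a`, then `x - a` is normal
to it. -/
theorem exists_inner_sub_eq_mul_of_level_subset_sphere {v : E → ℝ} {v' : E →L[ℝ] ℝ} {x a : E}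
    (hv : HasStrictFDerivAt v v' x) (hv' : v' ≠ 0)
    (h : ∀ᶠ z in 𝓝 x, v z = v x → ‖z - a‖ = ‖x - a‖) :
    ∃ μ : ℝ, ∀ z, inner ℝ (x - a) z = μ * v' z := by
  have hφ : HasStrictFDerivAt (fun z : E => ‖z - a‖ ^ 2)
      ((2 • innerSL ℝ (x - a)).comp (ContinuousLinearMap.id ℝ E)) x :=
    (hasStrictFDerivAt_norm_sq (x - a)).comp x ((hasStrictFDerivAt_id x).sub_const a)
  -- The squared distance to a is constant on the level set, so x is trivially an extremum and
  -- Lagrange multipliers apply.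
  have hextr : IsLocalExtrOn (fun z : E => ‖z - a‖ ^ 2) {z | v z = v x} x := by
    left
    rw [IsMinFilter, eventually_nhdsWithin_iff]
    filter_upwards [h] with z hz hzv
    rw [hz hzv]
  obtain ⟨p, q, hpq, hlin⟩ := hextr.exists_multipliers_of_hasStrictFDerivAt_1d hv hφ
  have hlin' : ∀ z, p * v' z + q * (2 * inner ℝ (x - a) z) = 0 := fun z => by
    have := DFunLike.congr_fun hlin z
    simpa [two_mul, mul_add, inner_sub_left] using this
  have hq : q ≠ 0 := by
    rintro rfl
    have hp : p ≠ 0 := fun hp => hpq (by rw [hp]; rfl)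
    refine hv' (ContinuousLinearMap.ext fun z => ?_)
    have := hlin' z
    simpa [hp] using this
  refine ⟨-p / (2 * q), fun z => ?_⟩
  have := hlin' z
  field_simp
  linarith

end

section

variable {E : Type*} [NormedAddCommGroup E] [InnerProductSpace ℝ E]

/-- A smooth curve transverse to the level sets of `v`, parametrized by the values of `v`. -/
theorem exists_curve_transverse {v : E → ℝ} {x w : E} (hv : ContDiffAt ℝ ∞ v x)
    (hw : fderiv ℝ v x w ≠ 0) :
    ∃ γ : ℝ → E, ContDiffAt ℝ ∞ γ (v x) ∧ γ (v x) = x ∧ ∀ᶠ s in 𝓝 (v x), v (γ s) = s := by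
  -- The curve is the line x + τw, reparametrized by the inverse of the one-variable function v(x +
  -- τw).
  let l : ℝ → E := fun τ => x + τ • w
  have hl : ContDiff ℝ ∞ l := by fun_prop
  have hl0 : l 0 = x := by simp [l]
  have hv0 : ContDiffAt ℝ ∞ v (l 0) := by rwa [hl0]
  have hg : ContDiffAt ℝ ∞ (v ∘ l) 0 := hv0.comp 0 hl.contDiffAt
  have hl' : HasDerivAt l w 0 := by
    have := ((hasDerivAt_id (0 : ℝ)).smul_const w).const_add x
    rwa [one_smul] at this
  have hg' : HasDerivAt (v ∘ l) (fderiv ℝ v x w) 0 := by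
    have h1 : HasFDerivAt v (fderiv ℝ v x) (l 0) := by
      rw [hl0]
      exact (hv.differentiableAt (by simp)).hasFDerivAt
    exact h1.comp_hasDerivAt 0 hl'
  let e : ℝ ≃L[ℝ] ℝ := ContinuousLinearEquiv.unitsEquivAut ℝ (Units.mk0 _ hw)
  have hg'' : HasFDerivAt (v ∘ l) (e : ℝ →L[ℝ] ℝ) 0 := by
    have he : (e : ℝ →L[ℝ] ℝ) = ContinuousLinearMap.toSpanSingleton ℝ (fderiv ℝ v x w) := by
      ext
      simp [e]
    rw [he]
    exact hg'.hasFDerivAt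
  have hgx : (v ∘ l) 0 = v x := by simp [hl0]
  refine ⟨fun s => l (hg.localInverse hg'' (by simp) s), ?_, ?_, ?_⟩
  · have := hg.to_localInverse hg'' (by simp)
    rw [hgx] at this
    exact hl.contDiffAt.comp _ this
  · have := hg.localInverse_apply_image hg'' (by simp)
    rw [hgx] at this
    simp only [this, hl0]
  · have h1 := (hg.hasStrictFDerivAt' hg'' (by simp)).eventually_right_inverse
    rw [hgx] at h1
    exact h1

/-- Cramer's rule: two points of a sphere and nonparallel normals there determine the center. Here
Xᵢ is the vector from the center to the i-th point, and D, the difference of the points, does not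
involve the center. -/
theorem parallel_offset_eq {V₀ V₁ X₀ X₁ D : E} {μ₀ μ₁ : ℝ} (h0 : X₀ = μ₀ • V₀)
    (h1 : X₁ = μ₁ • V₁) (hD : X₀ - X₁ = D)
    (hdet : inner ℝ V₀ V₀ * inner ℝ V₁ V₁ - inner ℝ V₀ V₁ ^ 2 ≠ (0 : ℝ)) :
    μ₀ = (inner ℝ D V₀ * inner ℝ V₁ V₁ - inner ℝ D V₁ * inner ℝ V₀ V₁) /
      (inner ℝ V₀ V₀ * inner ℝ V₁ V₁ - inner ℝ V₀ V₁ ^ 2 : ℝ) := by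
  rw [eq_div_iff hdet, ← hD, h0, h1]
  simp only [inner_sub_left, inner_smul_left, conj_trivial, real_inner_comm V₀ V₁]
  ring

/-- Gram determinant of two vectors. -/
theorem gram_ne_zero {V₀ V₁ : E} (h0 : V₀ ≠ 0) (h : ∀ k : ℝ, V₁ ≠ k • V₀) :
    inner ℝ V₀ V₀ * inner ℝ V₁ V₁ - inner ℝ V₀ V₁ ^ 2 ≠ (0 : ℝ) := by
  intro hdet
  have h00 : inner ℝ V₀ V₀ ≠ (0 : ℝ) := fun h => h0 (inner_self_eq_zero.1 h)
  refine h (inner ℝ V₀ V₁ / inner ℝ V₀ V₀) ?_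
  rw [← sub_eq_zero, ← inner_self_eq_zero (𝕜 := ℝ)]
  simp only [inner_sub_left, inner_sub_right, inner_smul_left, inner_smul_right, conj_trivial,
    real_inner_comm V₀ V₁]
  field_simp
  linear_combination hdet

end

variable {n : ℕ}

theorem exists_orthogonal_ne_zero (hn : 2 ≤ n) (w : EuclideanSpace ℝ (Fin n)) :
    ∃ e : EuclideanSpace ℝ (Fin n), e ≠ 0 ∧ inner ℝ w e = 0 := by
  have h : LinearMap.ker (innerSL ℝ w).toLinearMap ≠ ⊥ :=
    LinearMap.ker_ne_bot_of_finrank_lt (by simp; omega)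
  obtain ⟨e, he, he0⟩ := Submodule.exists_mem_ne_zero_of_ne_bot h
  exact ⟨e, he0, by simpa using he⟩

/-- Near any point, the level set of a submersion contains another point off the normal line. -/
theorem exists_level_point_off_normal (hn : 2 ≤ n) {v : EuclideanSpace ℝ (Fin n) → ℝ}
    {x : EuclideanSpace ℝ (Fin n)} (hv : ContDiffAt ℝ ∞ v x) (hx : coordGrad v x ≠ 0)
    {B : Set (EuclideanSpace ℝ (Fin n))} (hB : B ∈ 𝓝 x) :
    ∃ z ∈ B, v z = v x ∧ ∀ k : ℝ, z - x ≠ k • coordGrad v x := by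
  set w := coordGrad v x with hw
  obtain ⟨e, he0, he⟩ := exists_orthogonal_ne_zero hn w
  have hww : inner ℝ w w ≠ (0 : ℝ) := fun h => hx (inner_self_eq_zero.1 h)
  have hee : inner ℝ e e ≠ (0 : ℝ) := fun h => he0 (inner_self_eq_zero.1 h)
  have hew : inner ℝ e w = (0 : ℝ) := by rw [real_inner_comm]; exact he
  -- The pair (v, ⟨e, ·⟩) is a submersion at x, hence open there: v can be kept fixed while ⟨e, ·⟩
  -- moves by δ ≠ 0, which no multiple of the normal w ⊥ e can achieve.
  have hd : HasStrictFDerivAt (fun y => (v y, inner ℝ e y))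
      ((fderiv ℝ v x).prod (innerSL ℝ e)) x :=
    (hv.hasStrictFDerivAt (by simp)).prodMk (innerSL ℝ e).hasStrictFDerivAt
  have hsurj : ((fderiv ℝ v x).prod (innerSL ℝ e)).range = ⊤ := by
    refine LinearMap.range_eq_top.2 fun p => ?_
    refine ⟨(p.1 / inner ℝ w w) • w + (p.2 / inner ℝ e e) • e, ?_⟩
    have h1 : ∀ z, fderiv ℝ v x z = inner ℝ w z := fun z => (inner_coordGrad v x z).symm
    ext
    · simp [h1, inner_add_right, inner_smul_right, he, -map_add, -map_smul,
        -inner_self_eq_norm_sq_to_K, div_mul_cancel₀ _ hww]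
    · simp [inner_add_right, inner_smul_right, hew, -map_add, -map_smul,
        -inner_self_eq_norm_sq_to_K, div_mul_cancel₀ _ hee]
  have hmap := hd.map_nhds_eq_of_surj hsurj
  have himg : (fun y => (v y, inner ℝ e y)) '' B ∈ 𝓝 (v x, inner ℝ e x) := by
    rw [← hmap]
    exact image_mem_map hB
  have hc : Tendsto (fun δ : ℝ => (v x, inner ℝ e x + δ)) (𝓝[≠] 0) (𝓝 (v x, inner ℝ e x)) := by
    have : Continuous fun δ : ℝ => (v x, inner ℝ e x + δ) := by fun_prop
    have := this.tendsto 0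
    rw [add_zero] at this
    exact this.mono_left nhdsWithin_le_nhds
  obtain ⟨δ, ⟨z, hzB, hz⟩, hδ⟩ := ((hc.eventually himg).and self_mem_nhdsWithin).exists
  rw [Prod.mk.injEq] at hz
  refine ⟨z, hzB, hz.1, fun k hk => hδ ?_⟩
  have h2 : inner ℝ e (z - x) = δ := by rw [inner_sub_right, hz.2]; ring
  rw [hk, inner_smul_right, hew, mul_zero] at h2
  exact h2.symm

/-- If the level sets of a submersion lie on spheres, then the centers depend smoothly on the
level. -/
theorem exists_contDiffAt_center (hn : 2 ≤ n) {B : Set (EuclideanSpace ℝ (Fin n))} (hB : IsOpen B)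
    {v : EuclideanSpace ℝ (Fin n) → ℝ} (hv : ContDiffOn ℝ ∞ v B)
    (hdv : ∀ x ∈ B, fderiv ℝ v x ≠ 0)
    {A : EuclideanSpace ℝ (Fin n) → EuclideanSpace ℝ (Fin n)}
    (hA : ∀ x ∈ B, ∀ y ∈ B, v x = v y → A x = A y ∧ ‖x - A x‖ = ‖y - A y‖)
    {x : EuclideanSpace ℝ (Fin n)} (hx : x ∈ B) :
    ∃ γ : ℝ → EuclideanSpace ℝ (Fin n), ContDiffAt ℝ ∞ γ (v x) ∧ γ (v x) = x ∧
      (∀ᶠ s in 𝓝 (v x), v (γ s) = s) ∧ ContDiffAt ℝ ∞ (fun s => A (γ s)) (v x) := by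
  have hvx : ∀ y ∈ B, ContDiffAt ℝ ∞ v y := fun y hy => hv.contDiffAt (hB.mem_nhds hy)
  have hgrad : ∀ y ∈ B, coordGrad v y ≠ 0 := fun y hy h0 => hdv y hy <| by
    ext z
    rw [← inner_coordGrad, h0]
    simp
  have hself : ∀ y ∈ B, fderiv ℝ v y (coordGrad v y) ≠ 0 := fun y hy h => by
    rw [← inner_coordGrad] at h
    exact hgrad y hy (inner_self_eq_zero.1 h)
  have hnormal : ∀ y ∈ B, ∃ μ : ℝ, y - A y = μ • coordGrad v y := fun y hy => by
    obtain ⟨μ, hμ⟩ := exists_inner_sub_eq_mul_of_level_subset_sphere (a := A y)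
      ((hvx y hy).hasStrictFDerivAt (by simp)) (hdv y hy) (by
        filter_upwards [hB.mem_nhds hy] with z hz hzy
        obtain ⟨h1, h2⟩ := hA z hz y hy hzy
        rw [← h2, h1])
    refine ⟨μ, ext_inner_right ℝ fun z => ?_⟩
    rw [hμ, inner_smul_left, inner_coordGrad]
    simp
  -- The center lies on the normal lines at x and at z. These lines are not parallel: both pass
  -- through A x, and parallelism would put z on the normal line at x.
  obtain ⟨z, hz, hzx, hzk⟩ := exists_level_point_off_normal hn (hvx x hx) (hgrad x hx)
    (hB.mem_nhds hx)
  obtain ⟨γ₀, hγ₀, hγ₀x, hvγ₀⟩ := exists_curve_transverse (hvx x hx) (hself x hx)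
  obtain ⟨γ₁, hγ₁, hγ₁z, hvγ₁⟩ := exists_curve_transverse (hvx z hz) (hself z hz)
  rw [hzx] at hγ₁ hγ₁z hvγ₁
  refine ⟨γ₀, hγ₀, hγ₀x, hvγ₀, ?_⟩
  set V₀ : ℝ → EuclideanSpace ℝ (Fin n) := fun s => coordGrad v (γ₀ s) with hV₀
  set V₁ : ℝ → EuclideanSpace ℝ (Fin n) := fun s => coordGrad v (γ₁ s) with hV₁
  have hV₀s : ContDiffAt ℝ ∞ V₀ (v x) :=
    ContDiffAt.comp (g := coordGrad v) (f := γ₀) (v x)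
      (by rw [hγ₀x]; exact contDiffAt_coordGrad (hvx x hx)) hγ₀
  have hV₁s : ContDiffAt ℝ ∞ V₁ (v x) :=
    ContDiffAt.comp (g := coordGrad v) (f := γ₁) (v x)
      (by rw [hγ₁z]; exact contDiffAt_coordGrad (hvx z hz)) hγ₁
  set G : ℝ → ℝ := fun s =>
    inner ℝ (V₀ s) (V₀ s) * inner ℝ (V₁ s) (V₁ s) - inner ℝ (V₀ s) (V₁ s) ^ 2 with hG
  have hGs : ContDiffAt ℝ ∞ G (v x) :=
    ((hV₀s.inner ℝ hV₀s).mul (hV₁s.inner ℝ hV₁s)).sub ((hV₀s.inner ℝ hV₁s).pow 2)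
  have hG0 : G (v x) ≠ 0 := by
    refine gram_ne_zero (by simpa [hV₀, hγ₀x] using hgrad x hx) fun k hk => ?_
    simp only [hV₀, hV₁, hγ₀x, hγ₁z] at hk
    obtain ⟨μ₀, hμ₀⟩ := hnormal x hx
    obtain ⟨μ₁, hμ₁⟩ := hnormal z hz
    refine hzk (μ₁ * k - μ₀) ?_
    rw [sub_smul, mul_smul, ← hk, ← hμ₁, ← hμ₀, (hA z hz x hx hzx).1]
    abel
  have hB₀ : ∀ᶠ s in 𝓝 (v x), γ₀ s ∈ B :=
    hγ₀.continuousAt.eventually (by rw [hγ₀x]; exact hB.mem_nhds hx)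
  have hB₁ : ∀ᶠ s in 𝓝 (v x), γ₁ s ∈ B :=
    hγ₁.continuousAt.eventually (by rw [hγ₁z]; exact hB.mem_nhds hz)
  -- No regularity of A is assumed; it follows from this formula, whose ingredients are smooth.
  have hsm : ContDiffAt ℝ ∞ (fun s => γ₀ s -
      ((inner ℝ (γ₀ s - γ₁ s) (V₀ s) * inner ℝ (V₁ s) (V₁ s)
        - inner ℝ (γ₀ s - γ₁ s) (V₁ s) * inner ℝ (V₀ s) (V₁ s)) / G s) • V₀ s) (v x) :=
    hγ₀.sub ((((((hγ₀.sub hγ₁).inner ℝ hV₀s).mul (hV₁s.inner ℝ hV₁s)).sub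
      (((hγ₀.sub hγ₁).inner ℝ hV₁s).mul (hV₀s.inner ℝ hV₁s))).div hGs hG0).smul hV₀s)
  refine hsm.congr_of_eventuallyEq ?_
  filter_upwards [hB₀, hB₁, hvγ₀, hvγ₁, hGs.continuousAt.eventually_ne hG0] with s h0 h1 hv0 hv1 hGs
  obtain ⟨μ₀, hμ₀⟩ := hnormal _ h0
  obtain ⟨μ₁, hμ₁⟩ := hnormal _ h1
  have hAA := (hA _ h0 _ h1 (hv0.trans hv1.symm)).1
  have := parallel_offset_eq hμ₀ hμ₁ (D := γ₀ s - γ₁ s) (by rw [hAA]; abel) hGs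
  rw [← this, ← hμ₀]
  abel

end

/-! ### Divergence of the unit normal of a graph -/

section

variable {n : ℕ}

/-- The function `t - φ(x)` whose zero set is the graph of `φ`. -/
def graphFun (φ : EuclideanSpace ℝ (Fin n) → ℝ) (z : Amb n) : ℝ := z.2 - φ z.1

theorem hasFDerivAt_graphFun {φ : EuclideanSpace ℝ (Fin n) → ℝ} {z : Amb n}
    (hφ : DifferentiableAt ℝ φ z.1) :
    HasFDerivAt (graphFun φ) (ContinuousLinearMap.snd ℝ _ _ -
      (fderiv ℝ φ z.1).comp (ContinuousLinearMap.fst ℝ _ _)) z :=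
  hasFDerivAt_snd.sub (hφ.hasFDerivAt.comp z hasFDerivAt_fst)

theorem partialT_graphFun {φ : EuclideanSpace ℝ (Fin n) → ℝ} {z : Amb n}
    (hφ : DifferentiableAt ℝ φ z.1) : partialT (graphFun φ) z = 1 := by
  simp [partialT, (hasFDerivAt_graphFun hφ).fderiv]

theorem partialX_graphFun {φ : EuclideanSpace ℝ (Fin n) → ℝ} {z : Amb n}
    (hφ : DifferentiableAt ℝ φ z.1) (i : Fin n) :
    partialX i (graphFun φ) z = -coordGrad φ z.1 i := by
  simp [partialX, (hasFDerivAt_graphFun hφ).fderiv, coordGrad]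

variable [NeZero n]

theorem lorentzGrad_graphFun {φ : EuclideanSpace ℝ (Fin n) → ℝ} {z : Amb n}
    (hφ : DifferentiableAt ℝ φ z.1) :
    lorentzGrad (graphFun φ) z = (-((z.1 ⊤) ^ 2 • coordGrad φ z.1), -1) := by
  refine Prod.ext ?_ ?_
  · ext i
    simp [lorentzGrad, partialX_graphFun hφ]
  · simp [lorentzGrad, partialT_graphFun hφ]

theorem lorentzMetric_lorentzGrad_graphFun {φ : EuclideanSpace ℝ (Fin n) → ℝ} {z : Amb n}
    (hφ : DifferentiableAt ℝ φ z.1) :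
    lorentzMetric z (lorentzGrad (graphFun φ) z) (lorentzGrad (graphFun φ) z)
      = (z.1 ⊤) ^ 2 * ‖coordGrad φ z.1‖ ^ 2 - 1 := by
  rw [lorentzGrad_graphFun hφ, lorentzMetric]
  simp only [inner_neg_left, inner_neg_right, inner_smul_left, inner_smul_right,
    real_inner_self_eq_norm_sq, conj_trivial]
  field_simp

/-- The divergence of the unit normal of a graph whose weighted normalized gradient is radial up
to a factor: `x_n^{2-n} ∇φ / W = -K (x - α)`. -/
theorem lorentzDiv_unitGrad_graphFun {φ : EuclideanSpace ℝ (Fin n) → ℝ}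
    {x : EuclideanSpace ℝ (Fin n)} {t : ℝ} (hφ : ∀ᶠ z in 𝓝 x, DifferentiableAt ℝ φ z)
    (hpos : 0 < x ⊤) {K : EuclideanSpace ℝ (Fin n) → ℝ} {K' : EuclideanSpace ℝ (Fin n) →L[ℝ] ℝ}
    {α : EuclideanSpace ℝ (Fin n) → EuclideanSpace ℝ (Fin n)}
    {D : EuclideanSpace ℝ (Fin n) →L[ℝ] ℝ} {b : EuclideanSpace ℝ (Fin n)}
    (hK : HasFDerivAt K K' x) (hα : HasFDerivAt α (D.smulRight b) x)
    (heq : ∀ᶠ z in 𝓝 x, ∀ i, ((z ⊤) ^ n)⁻¹ * ((√(1 - (z ⊤) ^ 2 * ‖coordGrad φ z‖ ^ 2))⁻¹ *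
      -((z ⊤) ^ 2 * coordGrad φ z i)) = K z * (z i - α z i)) :
    lorentzDiv (unitGrad (graphFun φ)) (x, t) = (x ⊤) ^ n * (K' (x - α x) + K x * (n - D b)) := by
  have hposE : ∀ᶠ z : EuclideanSpace ℝ (Fin n) in 𝓝 x, 0 < z ⊤ := by
    have : Continuous fun z : EuclideanSpace ℝ (Fin n) => z ⊤ := by fun_prop
    exact this.continuousAt.eventually (lt_mem_nhds hpos)
  have hfst : Tendsto (fun z : Amb n => z.1) (𝓝 (x, t)) (𝓝 x) := continuousAt_fst
  have hunit : ∀ᶠ z in 𝓝 ((x, t) : Amb n), unitGrad (graphFun φ) z =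
      (√(1 - (z.1 ⊤) ^ 2 * ‖coordGrad φ z.1‖ ^ 2))⁻¹ •
        ((-((z.1 ⊤) ^ 2 • coordGrad φ z.1), -1) : Amb n) := by
    filter_upwards [hfst.eventually hφ, hfst.eventually hposE] with z h1 h2
    rw [unitGrad, lorentzMetric_lorentzGrad_graphFun h1, lorentzGrad_graphFun h1]
    congr 3
    ring
  have hX : ∀ i, partialX i (fun z => volDensity z * (unitGrad (graphFun φ) z).1 i) (x, t)
      = K' (EuclideanSpace.single i 1) * (x i - α x i)
        + K x * (1 - D (EuclideanSpace.single i 1) * b i) := by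
    intro i
    have hev : (fun z => volDensity z * (unitGrad (graphFun φ) z).1 i) =ᶠ[𝓝 ((x, t) : Amb n)]
        (fun z : EuclideanSpace ℝ (Fin n) => K z * (z i - α z i)) ∘ Prod.fst := by
      filter_upwards [hunit, hfst.eventually heq] with z h1 h2
      rw [h1, Function.comp, ← h2 i]
      simp [volDensity]
    have hd : HasFDerivAt (fun z : EuclideanSpace ℝ (Fin n) => K z * (z i - α z i))
        (K x • ((EuclideanSpace.proj i : EuclideanSpace ℝ (Fin n) →L[ℝ] ℝ) -
          (EuclideanSpace.proj i : EuclideanSpace ℝ (Fin n) →L[ℝ] ℝ).comp (D.smulRight b))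
          + (x i - α x i) • K') x := by
      refine hK.mul (HasFDerivAt.sub ?_ ?_)
      · exact (EuclideanSpace.proj i : EuclideanSpace ℝ (Fin n) →L[ℝ] ℝ).hasFDerivAt
      · exact (EuclideanSpace.proj i : EuclideanSpace ℝ (Fin n) →L[ℝ] ℝ).hasFDerivAt.comp x hα
    have hd' : HasFDerivAt ((fun z : EuclideanSpace ℝ (Fin n) => K z * (z i - α z i)) ∘ Prod.fst)
        _ ((x, t) : Amb n) := HasFDerivAt.comp (x, t) hd hasFDerivAt_fst
    rw [partialX, hev.fderiv_eq, hd'.fderiv]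
    simp
    ring
  have hT : partialT (fun z => volDensity z * (unitGrad (graphFun φ) z).2) (x, t) = 0 := by
    have hline : Continuous fun τ : ℝ => ((x, t + τ) : Amb n) := by fun_prop
    let g : EuclideanSpace ℝ (Fin n) → ℝ := fun z =>
      ((z ⊤) ^ n)⁻¹ * ((√(1 - (z ⊤) ^ 2 * ‖coordGrad φ z‖ ^ 2))⁻¹ * -1)
    have hev : (fun z => volDensity z * (unitGrad (graphFun φ) z).2) =ᶠ[𝓝 ((x, t) : Amb n)]
        g ∘ Prod.fst := by
      filter_upwards [hunit] with z h1
      rw [h1]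
      simp [volDensity, g]
    rw [partialT, hev.fderiv_eq]
    -- Nothing here depends on t. Differentiability of g is not established; if it fails, `fderiv`
    -- is 0 by convention, which is the required value.
    by_cases hd : DifferentiableAt ℝ (g ∘ Prod.fst) ((x, t) : Amb n)
    · have h1 : HasDerivAt (fun τ : ℝ => ((x, t + τ) : Amb n)) ((0, 1) : Amb n) 0 :=
        (hasDerivAt_const (0 : ℝ) x).prodMk ((hasDerivAt_id (0 : ℝ)).const_add t)
      have h2 : HasFDerivAt (g ∘ Prod.fst) (fderiv ℝ (g ∘ Prod.fst) ((x, t) : Amb n))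
          ((x, t + 0) : Amb n) := by
        rw [add_zero]
        exact hd.hasFDerivAt
      have h3 := h2.comp_hasDerivAt (0 : ℝ) h1
      exact h3.unique (hasDerivAt_const (0 : ℝ) (g x))
    · rw [fderiv_zero_of_not_differentiableAt hd]
      rfl
  have hK' : ∑ i, K' (EuclideanSpace.single i 1) * (x i - α x i) = K' (x - α x) := by
    rw [← inner_toLp_apply_single K']
    simp [PiLp.inner_apply, mul_comm]
  have hD : ∑ i, D (EuclideanSpace.single i 1) * b i = D b := by
    rw [← inner_toLp_apply_single D b]
    simp [PiLp.inner_apply, mul_comm]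
  rw [lorentzDiv, hT, Finset.sum_congr rfl fun i _ => hX i, Finset.sum_add_distrib, hK',
    ← Finset.mul_sum, Finset.sum_sub_distrib, hD]
  simp [volDensity]

end

/-! ### The mean curvature equation of a graph foliated by spheres -/

/-- A spacelike graph `t = φ(x)` over `B` foliated by pieces of horizontal Euclidean spheres: the
level set `{v = s}` lies on the sphere of center `a s` and squared radius `ρ s`, and `φ = τ s`
there. Primes are derivatives with respect to `s`. -/
structure IsSphereGraph {n : ℕ} [NeZero n] (B : Set (EuclideanSpace ℝ (Fin n))) (J : Set ℝ)
    (v φ : EuclideanSpace ℝ (Fin n) → ℝ) (a a' a'' : ℝ → EuclideanSpace ℝ (Fin n))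
    (ρ ρ' ρ'' τ τ' τ'' : ℝ → ℝ) : Prop where
  isOpen : IsOpen B
  isOpen_levels : IsOpen J
  mapsTo : ∀ x ∈ B, v x ∈ J
  top_pos : ∀ x ∈ B, 0 < x ⊤
  diff_v : ∀ x ∈ B, DifferentiableAt ℝ v x
  diff_φ : ∀ x ∈ B, DifferentiableAt ℝ φ x
  deriv_a : ∀ s ∈ J, HasDerivAt a (a' s) s
  deriv_a' : ∀ s ∈ J, HasDerivAt a' (a'' s) s
  deriv_ρ : ∀ s ∈ J, HasDerivAt ρ (ρ' s) s
  deriv_ρ' : ∀ s ∈ J, HasDerivAt ρ' (ρ'' s) s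
  deriv_τ : ∀ s ∈ J, HasDerivAt τ (τ' s) s
  deriv_τ' : ∀ s ∈ J, HasDerivAt τ' (τ'' s) s
  cont_a'' : ContinuousOn a'' J
  cont_ρ'' : ContinuousOn ρ'' J
  sphere : ∀ x ∈ B, ‖x - a (v x)‖ ^ 2 = ρ (v x)
  ρ_pos : ∀ x ∈ B, 0 < ρ (v x)
  center_top_pos : ∀ x ∈ B, 0 < a (v x) ⊤
  ρ_lt : ∀ x ∈ B, ρ (v x) < a (v x) ⊤ ^ 2
  graph : ∀ x ∈ B, φ x = τ (v x)
  spacelike : ∀ x ∈ B, x ⊤ ^ 2 * ‖coordGrad φ x‖ ^ 2 < 1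

/-- Half the derivative of `|x - a(s)|² - ρ(s)` in `s`. -/
def lapse {n : ℕ} (a a' : ℝ → EuclideanSpace ℝ (Fin n)) (ρ' : ℝ → ℝ)
    (x : EuclideanSpace ℝ (Fin n)) (s : ℝ) : ℝ :=
  -(inner ℝ (x - a s) (a' s) + ρ' s / 2)

namespace IsSphereGraph

variable {n : ℕ} [NeZero n] {B : Set (EuclideanSpace ℝ (Fin n))} {J : Set ℝ}
  {v φ : EuclideanSpace ℝ (Fin n) → ℝ} {a a' a'' : ℝ → EuclideanSpace ℝ (Fin n)}
  {ρ ρ' ρ'' τ τ' τ'' : ℝ → ℝ}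

theorem hasFDerivAt_center (G : IsSphereGraph B J v φ a a' a'' ρ ρ' ρ'' τ τ' τ'')
    {x : EuclideanSpace ℝ (Fin n)} (hx : x ∈ B) :
    HasFDerivAt (fun z => a (v z)) ((fderiv ℝ v x).smulRight (a' (v x))) x := by
  have he : (fderiv ℝ v x).smulRight (a' (v x)) =
      (ContinuousLinearMap.toSpanSingleton ℝ (a' (v x))).comp (fderiv ℝ v x) := by
    ext1 z
    simp
  rw [he]
  exact (G.deriv_a _ (G.mapsTo x hx)).hasFDerivAt.comp x (G.diff_v x hx).hasFDerivAt

theorem hasFDerivAt_center' (G : IsSphereGraph B J v φ a a' a'' ρ ρ' ρ'' τ τ' τ'')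
    {x : EuclideanSpace ℝ (Fin n)} (hx : x ∈ B) :
    HasFDerivAt (fun z => a' (v z)) ((fderiv ℝ v x).smulRight (a'' (v x))) x := by
  have he : (fderiv ℝ v x).smulRight (a'' (v x)) =
      (ContinuousLinearMap.toSpanSingleton ℝ (a'' (v x))).comp (fderiv ℝ v x) := by
    ext1 z
    simp
  rw [he]
  exact (G.deriv_a' _ (G.mapsTo x hx)).hasFDerivAt.comp x (G.diff_v x hx).hasFDerivAt

/-- Differentiate ‖x - a(v x)‖² = ρ(v x) in x. -/
theorem lapse_mul_fderiv (G : IsSphereGraph B J v φ a a' a'' ρ ρ' ρ'' τ τ' τ'')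
    {x : EuclideanSpace ℝ (Fin n)} (hx : x ∈ B) (z : EuclideanSpace ℝ (Fin n)) :
    lapse a a' ρ' x (v x) * fderiv ℝ v x z = -inner ℝ (x - a (v x)) z := by
  have h1 := ((hasFDerivAt_id x).sub (G.hasFDerivAt_center hx)).norm_sq
  have h2 := (G.deriv_ρ _ (G.mapsTo x hx)).comp_hasFDerivAt x (G.diff_v x hx).hasFDerivAt
  have h3 : (fun z => ‖z - a (v z)‖ ^ 2) =ᶠ[𝓝 x] ρ ∘ v := by
    filter_upwards [G.isOpen.mem_nhds hx] with z hz
    exact G.sphere z hz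
  have h4 := DFunLike.congr_fun (h1.unique (h2.congr_of_eventuallyEq h3)) z
  simp at h4
  rw [lapse]
  simp only [inner_sub_left] at h4 ⊢
  linear_combination h4 / 2

/-- Otherwise the previous relation, applied to x - a, would give ρ = 0. -/
theorem lapse_ne_zero (G : IsSphereGraph B J v φ a a' a'' ρ ρ' ρ'' τ τ' τ'')
    {x : EuclideanSpace ℝ (Fin n)} (hx : x ∈ B) : lapse a a' ρ' x (v x) ≠ 0 := by
  intro h
  have h1 := G.lapse_mul_fderiv hx (x - a (v x))
  rw [h, zero_mul, real_inner_self_eq_norm_sq, G.sphere x hx] at h1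
  linarith [G.ρ_pos x hx]

/-- The chain rule for φ = τ ∘ v: the gradient of the height is radial on each leaf, which makes the
divergence computable. -/
theorem lapse_smul_coordGrad (G : IsSphereGraph B J v φ a a' a'' ρ ρ' ρ'' τ τ' τ'')
    {x : EuclideanSpace ℝ (Fin n)} (hx : x ∈ B) :
    lapse a a' ρ' x (v x) • coordGrad φ x = -(τ' (v x) • (x - a (v x))) := by
  have h2 := (G.deriv_τ _ (G.mapsTo x hx)).comp_hasFDerivAt x (G.diff_v x hx).hasFDerivAt
  have h3 : φ =ᶠ[𝓝 x] τ ∘ v := by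
    filter_upwards [G.isOpen.mem_nhds hx] with z hz
    exact G.graph z hz
  have h4 := (h2.congr_of_eventuallyEq h3).fderiv
  refine ext_inner_right ℝ fun z => ?_
  rw [inner_smul_left, inner_coordGrad, h4]
  have := G.lapse_mul_fderiv hx z
  simp [inner_smul_left, inner_sub_left] at this ⊢
  linear_combination τ' (v x) * this

/-- `L² |∇f|²` for `f = t - φ`. -/
theorem lapse_sq_mul (G : IsSphereGraph B J v φ a a' a'' ρ ρ' ρ'' τ τ' τ'')
    {x : EuclideanSpace ℝ (Fin n)} (hx : x ∈ B) :
    lapse a a' ρ' x (v x) ^ 2 * (1 - x ⊤ ^ 2 * ‖coordGrad φ x‖ ^ 2)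
      = lapse a a' ρ' x (v x) ^ 2 - τ' (v x) ^ 2 * ρ (v x) * x ⊤ ^ 2 := by
  have h := congrArg (fun u => ‖u‖ ^ 2) (G.lapse_smul_coordGrad hx)
  simp only [norm_neg, norm_smul, mul_pow, Real.norm_eq_abs, sq_abs, G.sphere x hx] at h
  linear_combination -x ⊤ ^ 2 * h

theorem sq_sub_pos (G : IsSphereGraph B J v φ a a' a'' ρ ρ' ρ'' τ τ' τ'')
    {x : EuclideanSpace ℝ (Fin n)} (hx : x ∈ B) :
    0 < lapse a a' ρ' x (v x) ^ 2 - τ' (v x) ^ 2 * ρ (v x) * x ⊤ ^ 2 := by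
  rw [← G.lapse_sq_mul hx]
  exact mul_pos (by positivity [G.lapse_ne_zero hx]) (by linarith [G.spacelike x hx])

theorem hasFDerivAt_lapse (G : IsSphereGraph B J v φ a a' a'' ρ ρ' ρ'' τ τ' τ'')
    {x : EuclideanSpace ℝ (Fin n)} (hx : x ∈ B) :
    ∃ L' : EuclideanSpace ℝ (Fin n) →L[ℝ] ℝ,
      HasFDerivAt (fun z => lapse a a' ρ' z (v z)) L' x ∧
      ∀ z, L' z = -inner ℝ z (a' (v x)) + fderiv ℝ v x z *
        (inner ℝ (a' (v x)) (a' (v x)) - inner ℝ (x - a (v x)) (a'' (v x)) - ρ'' (v x) / 2) := by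
  have h1 := ((hasFDerivAt_id x).sub (G.hasFDerivAt_center hx)).inner ℝ (G.hasFDerivAt_center' hx)
  have h2 := (G.deriv_ρ' _ (G.mapsTo x hx)).comp_hasFDerivAt x (G.diff_v x hx).hasFDerivAt
  refine ⟨_, (h1.add (h2.mul_const (2⁻¹ : ℝ))).neg, fun z => ?_⟩
  simp [inner_sub_left, inner_smul_left, inner_smul_right]
  ring

end IsSphereGraph

namespace IsSphereGraph

variable {n : ℕ} [NeZero n] {B : Set (EuclideanSpace ℝ (Fin n))} {J : Set ℝ}
  {v φ : EuclideanSpace ℝ (Fin n) → ℝ} {a a' a'' : ℝ → EuclideanSpace ℝ (Fin n)}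
  {ρ ρ' ρ'' τ τ' τ'' : ℝ → ℝ}

/-- The weighted normalized gradient of a graph foliated by horizontal spheres is radial. -/
theorem normalized_grad_eq (G : IsSphereGraph B J v φ a a' a'' ρ ρ' ρ'' τ τ' τ'')
    {x : EuclideanSpace ℝ (Fin n)} (hx : x ∈ B) (i : Fin n) :
    ((x ⊤) ^ n)⁻¹ * ((√(1 - (x ⊤) ^ 2 * ‖coordGrad φ x‖ ^ 2))⁻¹ * -((x ⊤) ^ 2 * coordGrad φ x i))
      = (|lapse a a' ρ' x (v x)| / lapse a a' ρ' x (v x)) * (((x ⊤) ^ n)⁻¹ * (x ⊤) ^ 2 * τ' (v x) *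
        (√(lapse a a' ρ' x (v x) ^ 2 - τ' (v x) ^ 2 * ρ (v x) * x ⊤ ^ 2))⁻¹)
        * (x i - a (v x) i) := by
  have hL := G.lapse_ne_zero hx
  have hg := congrArg (fun u => u i) (G.lapse_smul_coordGrad hx)
  simp at hg
  rw [← G.lapse_sq_mul hx, Real.sqrt_mul (sq_nonneg _), Real.sqrt_sq_eq_abs]
  have hS : √(1 - x ⊤ ^ 2 * ‖coordGrad φ x‖ ^ 2) ≠ 0 :=
    (Real.sqrt_pos.2 (by linarith [G.spacelike x hx])).ne'
  have hy : (x ⊤) ^ n ≠ 0 := pow_ne_zero _ (G.top_pos x hx).ne'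
  have hLa : |lapse a a' ρ' x (v x)| ≠ 0 := abs_ne_zero.2 hL
  field_simp
  linear_combination -x ⊤ ^ 2 * hg

theorem continuousAt_lapse (G : IsSphereGraph B J v φ a a' a'' ρ ρ' ρ'' τ τ' τ'')
    {x : EuclideanSpace ℝ (Fin n)} (hx : x ∈ B) :
    ContinuousAt (fun z => lapse a a' ρ' z (v z)) x := by
  obtain ⟨L', hL', -⟩ := G.hasFDerivAt_lapse hx
  exact hL'.continuousAt

theorem eventually_sign_lapse (G : IsSphereGraph B J v φ a a' a'' ρ ρ' ρ'' τ τ' τ'')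
    {x : EuclideanSpace ℝ (Fin n)} (hx : x ∈ B) :
    ∃ σ : ℝ, σ ^ 2 = 1 ∧
      ∀ᶠ z in 𝓝 x, |lapse a a' ρ' z (v z)| / lapse a a' ρ' z (v z) = σ := by
  rcases (G.lapse_ne_zero hx).lt_or_gt with h | h
  · refine ⟨-1, by norm_num, ?_⟩
    filter_upwards [(G.continuousAt_lapse hx).eventually (gt_mem_nhds h)] with z hz
    rw [abs_of_neg hz, neg_div, div_self hz.ne]
  · refine ⟨1, by norm_num, ?_⟩
    filter_upwards [(G.continuousAt_lapse hx).eventually (lt_mem_nhds h)] with z hz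
    rw [abs_of_pos hz, div_self hz.ne']

/-- The mean curvature equation of a graph foliated by horizontal spheres. -/
theorem mean_curvature_eq (G : IsSphereGraph B J v φ a a' a'' ρ ρ' ρ'' τ τ' τ'')
    {x : EuclideanSpace ℝ (Fin n)} (hx : x ∈ B) {H t : ℝ}
    (hH : n * H = -lorentzDiv (unitGrad (graphFun φ)) (x, t)) {y L Q : ℝ} (hy : y = x ⊤)
    (hL : L = lapse a a' ρ' x (v x))
    (hQ : Q = inner ℝ (a' (v x)) (a' (v x)) - inner ℝ (x - a (v x)) (a'' (v x)) - ρ'' (v x) / 2) :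
    (n * H) ^ 2 * (L ^ 2 - τ' (v x) ^ 2 * ρ (v x) * y ^ 2) ^ 3 =
      y ^ 2 * (y * τ'' (v x) * ρ (v x) * L + y * τ' (v x) * L * ρ' (v x)
        - (n - 2) * a (v x) ⊤ * τ' (v x) * L ^ 2
        + (n - 1) * a (v x) ⊤ * τ' (v x) ^ 3 * ρ (v x) * y ^ 2
        - y * τ' (v x) * Q * ρ (v x)) ^ 2 := by
  -- Taking L² out of the square root leaves the locally constant sign σ of L. The final squaring
  -- removes both σ and the root S.
  obtain ⟨σ, hσ, hsgn⟩ := G.eventually_sign_lapse hx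
  obtain ⟨L', hL', hL'z⟩ := G.hasFDerivAt_lapse hx
  have hW0 := G.sq_sub_pos hx
  have hyd : HasFDerivAt (fun z : EuclideanSpace ℝ (Fin n) => z ⊤)
      (EuclideanSpace.proj ⊤ : EuclideanSpace ℝ (Fin n) →L[ℝ] ℝ) x :=
    (EuclideanSpace.proj ⊤ : EuclideanSpace ℝ (Fin n) →L[ℝ] ℝ).hasFDerivAt
  have hv := (G.diff_v x hx).hasFDerivAt
  have hp : HasFDerivAt (fun z => τ' (v z)) _ x := (G.deriv_τ' _ (G.mapsTo x hx)).comp_hasFDerivAt x hv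
  have hρ : HasFDerivAt (fun z => ρ (v z)) _ x := (G.deriv_ρ _ (G.mapsTo x hx)).comp_hasFDerivAt x hv
  have hW := ((hL'.pow 2).sub (((hp.pow 2).mul hρ).mul (hyd.pow 2))).sqrt hW0.ne'
  have hSinv := ((hasDerivAt_inv (Real.sqrt_pos.2 hW0).ne').comp_hasFDerivAt x hW)
  have hypos := G.top_pos x hx
  have hyinv := ((hasDerivAt_inv (pow_ne_zero n hypos.ne')).comp_hasFDerivAt x (hyd.pow n))
  have hK := (((hyinv.mul (hyd.pow 2)).mul hp).mul hSinv).const_mul σ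
  have hdiv := lorentzDiv_unitGrad_graphFun (t := t) (K := fun z => _) (α := fun z => a (v z))
    (by filter_upwards [G.isOpen.mem_nhds hx] with z hz using G.diff_φ z hz) hypos hK
    (G.hasFDerivAt_center hx) (by
      filter_upwards [G.isOpen.mem_nhds hx, hsgn] with z hz h1 i
      rw [G.normalized_grad_eq hz, h1]
      rfl)
  have hd := G.lapse_mul_fderiv hx (x - a (v x))
  rw [real_inner_self_eq_norm_sq, G.sphere x hx, ← hL] at hd
  have hda := G.lapse_mul_fderiv hx (a' (v x))
  have hXa : inner ℝ (x - a (v x)) (a' (v x)) = -L - ρ' (v x) / 2 := by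
    rw [hL, lapse]
    ring
  rw [← hL, hXa] at hda
  have hL'X := hL'z (x - a (v x))
  rw [← hQ, hXa] at hL'X
  -- Differentiating xₙⁿ produces xₙⁿ⁻¹, so all such powers are expressed through Y = yⁿ⁻¹, which
  -- then cancels.
  have hypn : x ⊤ ^ n = x ⊤ ^ (n - 1) * x ⊤ := by
    rw [← pow_succ, Nat.sub_add_cancel (NeZero.one_le)]
  rw [hdiv] at hH
  simp [-neg_add_rev, -map_sub] at hH
  have hL0 : L ≠ 0 := hL ▸ G.lapse_ne_zero hx
  have hS := Real.sq_sqrt hW0.le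
  have hS0 := (Real.sqrt_pos.2 hW0).ne'
  have hY0 : x ⊤ ^ (n - 1) ≠ 0 := pow_ne_zero _ hypos.ne'
  have hy0 : y ≠ 0 := hy ▸ hypos.ne'
  rw [hypn, ← hL, ← hy] at hH
  rw [← hL, ← hy] at hS hS0
  rw [← hy] at hY0
  have hd' : fderiv ℝ v x (x - a (v x)) = -ρ (v x) / L := by
    field_simp
    linear_combination hd
  have hda' : fderiv ℝ v x (a' (v x)) = (L + ρ' (v x) / 2) / L := by
    field_simp
    linear_combination 2 * hda
  rw [hL'X, hd', hda'] at hH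
  rw [← hS]
  generalize √(L ^ 2 - τ' (v x) ^ 2 * ρ (v x) * y ^ 2) = S at hH hS hS0 ⊢
  generalize y ^ (n - 1) = Y at hH hY0
  clear hdiv hK hyinv hSinv hW hρ hp hv hyd hL'X hda hd hXa hL'z hL' hsgn hypn hd' hda' hW0
  generalize a (v x) ⊤ = A at hH ⊢
  generalize τ' (v x) = p at hH hS ⊢
  generalize τ'' (v x) = p' at hH ⊢
  generalize ρ (v x) = r at hH hS ⊢
  generalize ρ' (v x) = r' at hH ⊢
  have hE : n * H * S ^ 3 = σ * (((n - 2) * y * (y - A) * p + y ^ 2 * p' * r / L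
      - y ^ 2 * p * (n - 1 - r' / (2 * L))) * S ^ 2
      + y ^ 2 * p * (L * (L + r' / 2 - r / L * Q) - p ^ 2 * r * y * (y - A)
        + y ^ 2 * (p ^ 2 * r' / 2 + r * p * p') * r / L)) := by
    rw [hH]
    field_simp
    ring
  -- Substituting S² = L² - p²ry² clears the denominators L and brings out a factor y.
  have hE' : n * H * S ^ 3 = σ * (y * (y * p' * r * L + y * p * L * r'
        - (n - 2) * A * p * L ^ 2 + (n - 1) * A * p ^ 3 * r * y ^ 2 - y * p * Q * r)) := by
    rw [hE, hS]
    field_simp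
    ring
  calc (n * H) ^ 2 * (S ^ 2) ^ 3 = (n * H * S ^ 3) ^ 2 := by ring
    _ = _ := by rw [hE', mul_pow, hσ]; ring

end IsSphereGraph

/-! ### Local rigidity in terms of the level parameter -/

theorem eventually_const_of_hasDerivAt_zero {f : ℝ → ℝ} {s₀ : ℝ}
    (h : ∀ᶠ s in 𝓝 s₀, HasDerivAt f 0 s) : ∀ᶠ s in 𝓝 s₀, f s = f s₀ := by
  obtain ⟨ε, hε, hb⟩ := Metric.eventually_nhds_iff_ball.1 h
  refine Metric.eventually_nhds_iff_ball.2 ⟨ε, hε, fun s hs => ?_⟩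
  exact Metric.isOpen_ball.is_const_of_deriv_eq_zero (convex_ball s₀ ε).isPreconnected
    (fun t ht => (hb t ht).differentiableAt.differentiableWithinAt)
    (fun t ht => (hb t ht).deriv) hs (Metric.mem_ball_self hε)

/-- Solutions of a scalar linear differential equation that vanish at a point vanish nearby. -/
theorem eventually_eq_zero_of_linear_ode {f g : ℝ → ℝ} {s₀ : ℝ} (hg : ContinuousAt g s₀)
    (h : ∀ᶠ s in 𝓝 s₀, HasDerivAt f (g s * f s) s) (h0 : f s₀ = 0) :
    ∀ᶠ s in 𝓝 s₀, f s = 0 := by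
  have hb : ∀ᶠ s in 𝓝 s₀, ‖g s‖ < ‖g s₀‖ + 1 :=
    hg.norm.eventually (gt_mem_nhds (by linarith))
  -- Comparison with the zero solution; near s₀ the coefficient is bounded by ‖g s₀‖ + 1, which
  -- serves as Lipschitz constant.
  refine ODE_solution_unique_of_eventually (v := fun s y => g s * y) (s := fun _ => Set.univ)
    (K := ⟨‖g s₀‖ + 1, by positivity⟩) (g := fun _ => 0) ?_ ?_ ?_ h0
  · filter_upwards [hb] with s hs
    refine LipschitzOnWith.of_dist_le_mul fun y _ z _ => ?_
    rw [dist_eq_norm, dist_eq_norm, ← mul_sub, norm_mul]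
    exact mul_le_mul_of_nonneg_right hs.le (norm_nonneg _)
  · filter_upwards [h] with s hs using ⟨hs, Set.mem_univ _⟩
  · refine Eventually.of_forall fun s => ⟨?_, Set.mem_univ _⟩
    rw [mul_zero]
    exact hasDerivAt_const s 0

namespace IsSphereGraph

variable {n : ℕ} [NeZero n] {B : Set (EuclideanSpace ℝ (Fin n))} {J : Set ℝ}
  {v φ : EuclideanSpace ℝ (Fin n) → ℝ} {a a' a'' : ℝ → EuclideanSpace ℝ (Fin n)}
  {ρ ρ' ρ'' τ τ' τ'' : ℝ → ℝ}

theorem hasDerivAt_norm_sub_sq (G : IsSphereGraph B J v φ a a' a'' ρ ρ' ρ'' τ τ' τ'')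
    {s : ℝ} (hs : s ∈ J) (z : EuclideanSpace ℝ (Fin n)) :
    HasDerivAt (fun s => ‖z - a s‖ ^ 2 - ρ s) (2 * lapse a a' ρ' z s) s := by
  have h := ((G.deriv_a s hs).const_sub z).norm_sq.sub (G.deriv_ρ s hs)
  refine h.congr_deriv ?_
  simp only [lapse, inner_neg_right]
  ring

/-- Near `x`, the level set of `v` through `x` is the whole sphere. -/
theorem eventually_level_of_sphere (G : IsSphereGraph B J v φ a a' a'' ρ ρ' ρ'' τ τ' τ'')
    {x : EuclideanSpace ℝ (Fin n)} (hx : x ∈ B) :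
    ∀ᶠ z in 𝓝 x, ‖z - a (v x)‖ ^ 2 = ρ (v x) → v z = v x := by
  have hJ := G.mapsTo x hx
  have hc : ContinuousAt (fun q : EuclideanSpace ℝ (Fin n) × ℝ => lapse a a' ρ' q.1 q.2)
      (x, v x) := by
    have h1 : ContinuousAt (fun q : EuclideanSpace ℝ (Fin n) × ℝ => a q.2) (x, v x) :=
      (G.deriv_a _ hJ).continuousAt.comp_of_eq continuousAt_snd rfl
    have h2 : ContinuousAt (fun q : EuclideanSpace ℝ (Fin n) × ℝ => a' q.2) (x, v x) :=
      (G.deriv_a' _ hJ).continuousAt.comp_of_eq continuousAt_snd rfl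
    have h3 : ContinuousAt (fun q : EuclideanSpace ℝ (Fin n) × ℝ => ρ' q.2) (x, v x) :=
      (G.deriv_ρ' _ hJ).continuousAt.comp_of_eq continuousAt_snd rfl
    exact (((continuousAt_fst.sub h1).inner h2).add (h3.div_const 2)).neg
  have hne := hc.eventually_ne (G.lapse_ne_zero hx)
  have hne2 : ∀ᶠ q : EuclideanSpace ℝ (Fin n) × ℝ in 𝓝 x ×ˢ 𝓝 (v x),
      lapse a a' ρ' q.1 q.2 ≠ 0 ∧ q.2 ∈ J := by
    rw [← nhds_prod_eq]
    exact hne.and (continuousAt_snd.eventually (G.isOpen_levels.mem_nhds hJ))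
  obtain ⟨U, hU, I, hI, hUI⟩ := eventually_prod_iff.1 hne2
  obtain ⟨ε, hε, hball⟩ := Metric.eventually_nhds_iff_ball.1 hI
  have hvI := (G.diff_v x hx).continuousAt.eventually (Metric.ball_mem_nhds (v x) hε)
  filter_upwards [hU, hvI, G.isOpen.mem_nhds hx] with z hzU hzI hzB hz
  by_contra hvz
  have hxI : v x ∈ Metric.ball (v x) ε := Metric.mem_ball_self hε
  have hoc : (Metric.ball (v x) ε).OrdConnected := (convex_ball (v x) ε).ordConnected
  -- Rolle: if z lay on the spheres of two nearby levels, the `lapse` at z would vanish at a level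
  -- in between, although it is nonzero near (x, v x).
  have key : ∀ s₁ ∈ Metric.ball (v x) ε, ∀ s₂ ∈ Metric.ball (v x) ε, s₁ < s₂ →
      ‖z - a s₁‖ ^ 2 = ρ s₁ → ‖z - a s₂‖ ^ 2 = ρ s₂ → False := by
    intro s₁ h₁ s₂ h₂ hlt he₁ he₂
    have hsub := hoc.out h₁ h₂
    have hder : ∀ s ∈ Set.Icc s₁ s₂, HasDerivAt (fun s => ‖z - a s‖ ^ 2 - ρ s)
        (2 * lapse a a' ρ' z s) s := fun s hs =>
      G.hasDerivAt_norm_sub_sq (hUI hzU (hball s (hsub hs))).2 z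
    obtain ⟨c, hc, hc0⟩ := exists_hasDerivAt_eq_zero hlt
      (fun s hs => (hder s hs).continuousAt.continuousWithinAt) (by rw [he₁, he₂]; ring)
      (fun s hs => hder s (Set.Ioo_subset_Icc_self hs))
    exact (hUI hzU (hball c (hsub (Set.Ioo_subset_Icc_self hc)))).1 (by linarith)
  rcases lt_or_gt_of_ne hvz with h | h
  · exact key _ hzI _ hxI h (G.sphere z hzB) hz
  · exact key _ hxI _ hzI h hz (G.sphere z hzB)

/-- The hyperbolic center of the leaves is infinitesimally constant. -/
theorem center_deriv_eq (hn : 2 ≤ n) (G : IsSphereGraph B J v φ a a' a'' ρ ρ' ρ'' τ τ' τ'')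
    {H : ℝ} (hH : ∀ x ∈ B, n * H = -lorentzDiv (unitGrad (graphFun φ)) (x, φ x))
    {x : EuclideanSpace ℝ (Fin n)} (hx : x ∈ B)
    (hne : H ≠ 0 ∨ H = 0 ∧ 3 ≤ n ∧ τ' (v x) ≠ 0) :
    a (v x) ⊤ • a' (v x) = (ρ' (v x) / 2) • EuclideanSpace.single ⊤ 1 := by
  set s := v x with hs
  set X := x - a s with hX
  have hρ := G.ρ_pos x hx
  rw [← hs] at hρ
  have hXX : inner ℝ X X = ρ s := by rw [real_inner_self_eq_norm_sq]; exact G.sphere x hx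
  have hatop := G.center_top_pos x hx
  rw [← hs] at hatop
  have hn0 : (n : ℝ) ≠ 0 := by exact_mod_cast NeZero.ne n
  rw [← sub_eq_zero]
  -- Each ζ ⊥ X, rescaled to η of length √ρ, spans with X the plane of a circle of the leaf through
  -- x.
  refine eq_zero_of_orthogonal_top (X := X) hn fun ζ hζ0 hXζ hor => ?_
  have hζn : 0 < ‖ζ‖ := norm_pos_iff.2 hζ0
  set k := √(ρ s) / ‖ζ‖ with hk
  have hk0 : 0 < k := div_pos (Real.sqrt_pos.2 hρ) hζn
  set η := k • ζ with hη
  have hηη : inner ℝ η η = ρ s := by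
    rw [real_inner_self_eq_norm_sq, hη, norm_smul, mul_pow, Real.norm_eq_abs, sq_abs, hk, div_pow,
      Real.sq_sqrt hρ.le]
    field_simp
  have hXη : inner ℝ X η = (0 : ℝ) := by rw [hη, inner_smul_right, hXζ, mul_zero]
  have hηX : inner ℝ η X = (0 : ℝ) := by rw [real_inner_comm, hXη]
  have hbessel := top_sq_add_top_sq_le hρ hXX hηη hXη
  have hηt : η ⊤ = k * ζ ⊤ := by simp [hη]
  have hbd : 0 < X ⊤ ^ 2 + η ⊤ ^ 2 := by
    rcases hor with h | h
    · positivity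
    · have : η ⊤ ≠ 0 := by rw [hηt]; exact mul_ne_zero hk0.ne' h
      positivity
  let z : ℝ → EuclideanSpace ℝ (Fin n) := fun θ => a s + Real.cos θ • X + Real.sin θ • η
  have hz : Continuous z := by fun_prop
  have hz0 : z 0 = x := by simp [z, hX]
  have hzx : Tendsto z (𝓝 0) (𝓝 x) := by
    have := hz.tendsto 0
    rwa [hz0] at this
  -- The triples are the coefficients of y, L, Q on the circle a + cos θ X + sin θ η. Bessel's
  -- inequality and ρ < aₙ² keep the zeros of y off the real axis.
  obtain ⟨h1, h2⟩ := affine_proportional_of_cubic (a := a s ⊤) (b := X ⊤) (d := η ⊤)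
    (l₀ := -(ρ' s / 2)) (l₁ := -inner ℝ X (a' s)) (l₂ := -inner ℝ η (a' s))
    (q₀ := inner ℝ (a' s) (a' s) - ρ'' s / 2) (q₁ := -inner ℝ X (a'' s))
    (q₂ := -inner ℝ η (a'' s)) (K := (n * H) ^ 2) (m := τ' s ^ 2 * ρ s)
    (k₁ := τ'' s * ρ s + τ' s * ρ' s) (k₂ := -((n - 2) * a s ⊤ * τ' s))
    (k₃ := (n - 1) * a s ⊤ * τ' s ^ 3 * ρ s) (k₄ := -(τ' s * ρ s)) hbd
    (hbessel.trans_lt (G.ρ_lt x hx)) (by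
      rcases hne with h | ⟨h, h3, h4⟩
      · exact Or.inl (pow_ne_zero 2 (mul_ne_zero hn0 h))
      · refine Or.inr ⟨by rw [h]; ring, neg_ne_zero.2 (mul_ne_zero (mul_ne_zero ?_ hatop.ne') h4)⟩
        have : (3 : ℝ) ≤ n := by exact_mod_cast h3
        linarith) (by
      filter_upwards [hzx.eventually (G.eventually_level_of_sphere hx),
        hzx.eventually (G.isOpen.mem_nhds hx)] with θ hθ hzB y L Q hy hL hQ
      have hza : z θ - a s = Real.cos θ • X + Real.sin θ • η := by simp only [z]; abel
      have hvz : v (z θ) = s := hθ (by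
        rw [← hs, hza, ← real_inner_self_eq_norm_sq]
        simp only [inner_add_left, inner_add_right, inner_smul_left, inner_smul_right, hXX, hηη,
          hXη, hηX, conj_trivial]
        linear_combination ρ s * Real.sin_sq_add_cos_sq θ)
      have hyz : y = z θ ⊤ := by simp [hy, z]; ring
      have h := G.mean_curvature_eq hzB (hH _ hzB) (y := y) (L := L) (Q := Q) hyz
        (by rw [hvz, lapse, hza, hL, inner_add_left, inner_smul_left X, inner_smul_left η,
          conj_trivial, conj_trivial]; ring)
        (by rw [hvz, hza, hQ, inner_add_left, inner_smul_left X, inner_smul_left η,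
          conj_trivial, conj_trivial]; ring)
      rw [hvz] at h
      refine ⟨hyz ▸ (G.top_pos _ hzB).ne', h.trans ?_⟩
      ring)
  refine ⟨?_, ?_⟩
  · rw [inner_sub_right, inner_smul_right, inner_smul_right, inner_single_top]
    linarith
  · rw [inner_sub_right, inner_smul_right, inner_smul_right, inner_single_top]
    rw [hηt, hη, inner_smul_left, conj_trivial] at h2
    have : k * (a s ⊤ * inner ℝ ζ (a' s) - ρ' s / 2 * ζ ⊤) = 0 := by linarith
    exact (mul_eq_zero.1 this).resolve_left hk0.ne'

/-- In a maximal graph the slope `τ'` satisfies a linear differential equation. -/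
theorem slope_ode (G : IsSphereGraph B J v φ a a' a'' ρ ρ' ρ'' τ τ' τ'')
    {x : EuclideanSpace ℝ (Fin n)} (hx : x ∈ B)
    (hH : 0 = -lorentzDiv (unitGrad (graphFun φ)) (x, φ x)) :
    τ'' (v x) = ((n - 2) * a (v x) ⊤ * lapse a a' ρ' x (v x) ^ 2
        - (n - 1) * a (v x) ⊤ * τ' (v x) ^ 2 * ρ (v x) * x ⊤ ^ 2
        + x ⊤ * (inner ℝ (a' (v x)) (a' (v x)) - inner ℝ (x - a (v x)) (a'' (v x))
          - ρ'' (v x) / 2) * ρ (v x) - x ⊤ * lapse a a' ρ' x (v x) * ρ' (v x))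
        / (x ⊤ * ρ (v x) * lapse a a' ρ' x (v x)) * τ' (v x) := by
  have h := G.mean_curvature_eq hx (H := 0) (by simpa using hH) rfl rfl rfl
  rw [mul_zero, zero_pow two_ne_zero, zero_mul] at h
  have h0 := (pow_eq_zero_iff two_ne_zero).1
    ((mul_eq_zero.1 h.symm).resolve_left (pow_ne_zero 2 (G.top_pos x hx).ne'))
  have h1 := (G.top_pos x hx).ne'
  have h2 := (G.ρ_pos x hx).ne'
  have h3 := G.lapse_ne_zero hx
  rw [div_mul_eq_mul_div, eq_div_iff (mul_ne_zero (mul_ne_zero h1 h2) h3)]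
  linear_combination h0

/-- The components of the hypothesis say aᵢ' = 0 for i ≠ ⊤ and (aₙ² - ρ)' = 0. For a hyperbolic
sphere with center c these constants are cᵢ and cₙ². -/
theorem center_eventually_const (G : IsSphereGraph B J v φ a a' a'' ρ ρ' ρ'' τ τ' τ'')
    {s₀ : ℝ} (hs₀ : s₀ ∈ J)
    (h : ∀ᶠ s in 𝓝 s₀, a s ⊤ ≠ 0 ∧
      a s ⊤ • a' s = (ρ' s / 2) • EuclideanSpace.single ⊤ 1) :
    ∀ᶠ s in 𝓝 s₀, (∀ i ≠ ⊤, a s i = a s₀ i) ∧ a s ⊤ ^ 2 - ρ s = a s₀ ⊤ ^ 2 - ρ s₀ := by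
  have hJ := G.isOpen_levels.mem_nhds hs₀
  have hcoord : ∀ s ∈ J, ∀ i, HasDerivAt (fun s => a s i) (a' s i) s := fun s hs i =>
    (EuclideanSpace.proj i : EuclideanSpace ℝ (Fin n) →L[ℝ] ℝ).hasFDerivAt.comp_hasDerivAt s
      (G.deriv_a s hs)
  refine (eventually_all.2 fun i => ?_).and ?_
  · by_cases hi : i = ⊤
    · exact Eventually.of_forall fun s h => absurd hi h
    · refine (eventually_const_of_hasDerivAt_zero (f := fun s => a s i) ?_).mono fun s hs _ => hs
      filter_upwards [h, hJ] with s hs hsJ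
      have := congrArg (fun u => u i) hs.2
      simp [hi, hs.1] at this
      have h2 := hcoord s hsJ i
      rwa [this] at h2
  · refine eventually_const_of_hasDerivAt_zero (f := fun s => a s ⊤ ^ 2 - ρ s) ?_
    filter_upwards [h, hJ] with s hs hsJ
    have := congrArg (fun u => u ⊤) hs.2
    simp at this
    refine (((hcoord s hsJ ⊤).pow 2).sub (G.deriv_ρ s hsJ)).congr_deriv ?_
    simp
    linear_combination 2 * this

/-- Local form of the rigidity theorem. -/
theorem eventually_center_const (hn : 2 ≤ n)
    (G : IsSphereGraph B J v φ a a' a'' ρ ρ' ρ'' τ τ' τ'') {H : ℝ}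
    (hH : ∀ x ∈ B, n * H = -lorentzDiv (unitGrad (graphFun φ)) (x, φ x))
    (hne : H ≠ 0 ∨ H = 0 ∧ 3 ≤ n) {x : EuclideanSpace ℝ (Fin n)} (hx : x ∈ B)
    {γ : ℝ → EuclideanSpace ℝ (Fin n)} (hγ : ContinuousAt γ (v x)) (hγx : γ (v x) = x)
    (hvγ : ∀ᶠ s in 𝓝 (v x), v (γ s) = s) :
    (H = 0 ∧ ∀ᶠ s in 𝓝 (v x), τ s = τ (v x)) ∨
    ∀ᶠ s in 𝓝 (v x), ((∀ i ≠ ⊤, a s i = a (v x) i) ∧ a s ⊤ ^ 2 - ρ s = a (v x) ⊤ ^ 2 - ρ (v x)) ∧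
      (H = 0 → τ' s ≠ 0) := by
  have hJ := G.mapsTo x hx
  have hγB : ∀ᶠ s in 𝓝 (v x), γ s ∈ B :=
    hγ.eventually (by rw [hγx]; exact G.isOpen.mem_nhds hx)
  -- The only obstruction to `center_deriv_eq` is a vanishing slope in the maximal case.
  by_cases hz : H = 0 ∧ τ' (v x) = 0
  · left
    refine ⟨hz.1, eventually_const_of_hasDerivAt_zero ?_⟩
    have h0 : ∀ᶠ s in 𝓝 (v x), τ' s = 0 := by
      have hρ := G.ρ_pos x hx
      have hL := G.lapse_ne_zero hx
      have hy := G.top_pos x hx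
      have ca := (G.deriv_a _ hJ).continuousAt
      have ca' := (G.deriv_a' _ hJ).continuousAt
      have ca'' := G.cont_a''.continuousAt (G.isOpen_levels.mem_nhds hJ)
      have cρ := (G.deriv_ρ _ hJ).continuousAt
      have cρ' := (G.deriv_ρ' _ hJ).continuousAt
      have cρ'' := G.cont_ρ''.continuousAt (G.isOpen_levels.mem_nhds hJ)
      have cτ' := (G.deriv_τ' _ hJ).continuousAt
      have cX : ContinuousAt (fun s => γ s - a s) (v x) := hγ.sub ca
      have cγt : ContinuousAt (fun s => γ s ⊤) (v x) :=
        (EuclideanSpace.proj ⊤ : EuclideanSpace ℝ (Fin n) →L[ℝ] ℝ).continuous.continuousAt.comp hγ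
      have cat : ContinuousAt (fun s => a s ⊤) (v x) :=
        (EuclideanSpace.proj ⊤ : EuclideanSpace ℝ (Fin n) →L[ℝ] ℝ).continuous.continuousAt.comp ca
      have cL : ContinuousAt (fun s => lapse a a' ρ' (γ s) s) (v x) :=
        ((cX.inner ca').add (cρ'.div_const 2)).neg
      -- Evaluating at γ s, a point of the level s, makes the coefficient a function of s alone. It
      -- contains τ' itself, but only its continuity along the given solution matters.
      refine eventually_eq_zero_of_linear_ode (g := fun s => ((n - 2) * a s ⊤ *
        lapse a a' ρ' (γ s) s ^ 2 - (n - 1) * a s ⊤ * τ' s ^ 2 * ρ s * γ s ⊤ ^ 2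
        + γ s ⊤ * (inner ℝ (a' s) (a' s) - inner ℝ (γ s - a s) (a'' s)
          - ρ'' s / 2) * ρ s - γ s ⊤ * lapse a a' ρ' (γ s) s * ρ' s)
        / (γ s ⊤ * ρ s * lapse a a' ρ' (γ s) s)) ?_ ?_ hz.2
      · have cI : ContinuousAt (fun s => inner ℝ (a' s) (a' s)) (v x) := ca'.inner ca'
        have cI' : ContinuousAt (fun s => inner ℝ (γ s - a s) (a'' s)) (v x) := cX.inner ca''
        refine ContinuousAt.div (by fun_prop) (by fun_prop) ?_
        rw [hγx]
        exact mul_ne_zero (mul_ne_zero hy.ne' hρ.ne') hL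
      · filter_upwards [hγB, hvγ, G.isOpen_levels.mem_nhds hJ] with s hsB hvs hsJ
        have := G.slope_ode hsB (by rw [← hH _ hsB, hz.1, mul_zero])
        rw [hvs] at this
        exact this ▸ G.deriv_τ' s hsJ
    filter_upwards [h0, G.isOpen_levels.mem_nhds hJ] with s hs hsJ
    exact hs ▸ G.deriv_τ s hsJ
  · right
    have h0 : ∀ᶠ s in 𝓝 (v x), H = 0 → τ' s ≠ 0 := by
      by_cases hH0 : H = 0
      · filter_upwards [(G.deriv_τ' _ hJ).continuousAt.eventually_ne fun h => hz ⟨hH0, h⟩] with s hs _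
        exact hs
      · exact Eventually.of_forall fun s h => absurd h hH0
    refine (G.center_eventually_const hJ ?_).and h0
    filter_upwards [hγB, hvγ, h0] with s hsB hvs hs0
    have h1 := G.center_deriv_eq hn hH hsB
      (hne.imp_right fun h => ⟨h.1, h.2, by rw [hvs]; exact hs0 h.1⟩)
    have h2 := (G.center_top_pos _ hsB).ne'
    rw [hvs] at h1 h2
    exact ⟨h2, h1⟩

end IsSphereGraph

/-! ### From a foliated graph to its level parametrization -/

section

theorem eventually_contDiffAt_two {E : Type*} [NormedAddCommGroup E] [NormedSpace ℝ E]
    {f : ℝ → E} {s : ℝ} (hf : ContDiffAt ℝ ∞ f s) : ∀ᶠ t in 𝓝 s, ContDiffAt ℝ 2 f t :=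
  (hf.of_le (ENat.LEInfty.out)).eventually (by simp)

theorem hasDerivAt_of_contDiffOn_two {E : Type*} [NormedAddCommGroup E] [NormedSpace ℝ E]
    {f : ℝ → E} {J : Set ℝ} (hJ : IsOpen J) (hf : ContDiffOn ℝ 2 f J) :
    (∀ s ∈ J, HasDerivAt f (deriv f s) s) ∧
      (∀ s ∈ J, HasDerivAt (deriv f) (deriv (deriv f) s) s) ∧
      ContinuousOn (deriv (deriv f)) J := by
  have h1 : ContDiffOn ℝ 1 (deriv f) J := hf.deriv_of_isOpen hJ (by norm_num)
  have h2 : ContDiffOn ℝ 0 (deriv (deriv f)) J := h1.deriv_of_isOpen hJ (by norm_num)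
  exact ⟨fun s hs => ((hf.contDiffAt (hJ.mem_nhds hs)).differentiableAt (by simp)).hasDerivAt,
    fun s hs => ((h1.contDiffAt (hJ.mem_nhds hs)).differentiableAt (by simp)).hasDerivAt,
    h2.continuousOn⟩

variable {n : ℕ} [NeZero n]

/-- Local rigidity: in a spacelike graph of constant mean curvature foliated by horizontal spheres,
either the graph is locally a maximal slice or the hyperbolic center of the leaves is locally
constant. -/
theorem graph_center_eventually_const (hn : 2 ≤ n) {B : Set (EuclideanSpace ℝ (Fin n))}
    (hB : IsOpen B) {x : EuclideanSpace ℝ (Fin n)} (hx : x ∈ B)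
    {v φ : EuclideanSpace ℝ (Fin n) → ℝ} (hv : ContDiffOn ℝ ∞ v B) (hφ : ContDiffOn ℝ ∞ φ B)
    (hdv : fderiv ℝ v x ≠ 0) (htop : ∀ z ∈ B, 0 < z ⊤)
    (hsp : x ⊤ ^ 2 * ‖coordGrad φ x‖ ^ 2 < 1)
    {A : EuclideanSpace ℝ (Fin n) → EuclideanSpace ℝ (Fin n)} {r : EuclideanSpace ℝ (Fin n) → ℝ}
    (hlev : ∀ z ∈ B, ∀ w ∈ B, v z = v w → A z = A w ∧ r z = r w ∧ φ z = φ w)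
    (hsph : ∀ z ∈ B, ‖z - A z‖ ^ 2 = r z) (hr : ∀ z ∈ B, 0 < r z) (hA : ∀ z ∈ B, 0 < A z ⊤)
    (hrA : ∀ z ∈ B, r z < A z ⊤ ^ 2) {H : ℝ}
    (hmc : ∀ z ∈ B, z ⊤ ^ 2 * ‖coordGrad φ z‖ ^ 2 < 1 →
      n * H = -lorentzDiv (unitGrad (graphFun φ)) (z, φ z))
    (hne : H ≠ 0 ∨ H = 0 ∧ 3 ≤ n) :
    (H = 0 ∧ ∀ᶠ z in 𝓝 x, φ z = φ x) ∨
    ∀ᶠ z in 𝓝 x, ((∀ i ≠ ⊤, A z i = A x i) ∧ A z ⊤ ^ 2 - r z = A x ⊤ ^ 2 - r x) ∧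
      (H = 0 → fderiv ℝ φ z ≠ 0) := by
  have hvat : ∀ z ∈ B, ContDiffAt ℝ ∞ v z := fun z hz => hv.contDiffAt (hB.mem_nhds hz)
  have hφat : ∀ z ∈ B, ContDiffAt ℝ ∞ φ z := fun z hz => hφ.contDiffAt (hB.mem_nhds hz)
  have hev₁ : ∀ᶠ z in 𝓝 x, fderiv ℝ v z ≠ 0 :=
    ((hvat x hx).continuousAt_fderiv (by simp)).eventually_ne hdv
  have hev₂ : ∀ᶠ z in 𝓝 x, z ⊤ ^ 2 * ‖coordGrad φ z‖ ^ 2 < 1 := by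
    have h1 := (contDiffAt_coordGrad (hφat x hx)).continuousAt
    have h2 : ContinuousAt (fun z : EuclideanSpace ℝ (Fin n) => z ⊤) x := by fun_prop
    exact ((h2.pow 2).mul (h1.norm.pow 2)).eventually (gt_mem_nhds hsp)
  obtain ⟨B₁, hB₁, hB₁o, hxB₁⟩ := eventually_nhds_iff.1 ((hB.eventually_mem hx).and (hev₁.and hev₂))
  have hlevr : ∀ z ∈ B₁, ∀ w ∈ B₁, v z = v w → A z = A w ∧ ‖z - A z‖ = ‖w - A w‖ := by
    intro z hz w hw hzw
    obtain ⟨h1, h2, -⟩ := hlev z (hB₁ z hz).1 w (hB₁ w hw).1 hzw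
    refine ⟨h1, ?_⟩
    rw [← hsph z (hB₁ z hz).1, ← hsph w (hB₁ w hw).1] at h2
    exact (sq_eq_sq₀ (norm_nonneg _) (norm_nonneg _)).1 h2
  obtain ⟨γ, hγ, hγx, hvγ, ha⟩ := exists_contDiffAt_center hn hB₁o
    (hv.mono fun z hz => (hB₁ z hz).1) (fun z hz => (hB₁ z hz).2.1) hlevr hxB₁
  set a : ℝ → EuclideanSpace ℝ (Fin n) := fun s => A (γ s) with ha_def
  set ρ : ℝ → ℝ := fun s => ‖γ s - a s‖ ^ 2 with hρ_def
  set τ : ℝ → ℝ := fun s => φ (γ s) with hτ_def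
  have hρ : ContDiffAt ℝ ∞ ρ (v x) := (hγ.sub ha).norm_sq ℝ
  have hτ : ContDiffAt ℝ ∞ τ (v x) :=
    ContDiffAt.comp (g := φ) (f := γ) (v x) (by rw [hγx]; exact hφat x hx) hγ
  have hγB : ∀ᶠ s in 𝓝 (v x), γ s ∈ B₁ :=
    hγ.continuousAt.eventually (by rw [hγx]; exact hB₁o.mem_nhds hxB₁)
  obtain ⟨J, hJ, hJo, hxJ⟩ := eventually_nhds_iff.1
    ((eventually_contDiffAt_two ha).and ((eventually_contDiffAt_two hρ).and
      ((eventually_contDiffAt_two hτ).and (hγB.and hvγ))))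
  have hvc : ContinuousAt v x := (hvat x hx).continuousAt
  obtain ⟨B₂, hB₂, hB₂o, hxB₂⟩ := eventually_nhds_iff.1
    ((hB₁o.eventually_mem hxB₁).and (hvc.eventually (hJo.mem_nhds hxJ)))
  have hB₂B : ∀ z ∈ B₂, z ∈ B := fun z hz => (hB₁ z (hB₂ z hz).1).1
  -- The points z and γ (v z) lie on the same level, so A, r and φ factor through v.
  have hfact : ∀ z ∈ B₂, A z = a (v z) ∧ r z = ρ (v z) ∧ φ z = τ (v z) := by
    intro z hz
    obtain ⟨-, -, -, h4, h5⟩ := hJ _ (hB₂ z hz).2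
    obtain ⟨h1, h2, h3⟩ := hlev z (hB₂B z hz) _ (hB₁ _ h4).1 h5.symm
    exact ⟨h1, by rw [h2, ← hsph _ (hB₁ _ h4).1], h3⟩
  obtain ⟨da, da', ca''⟩ := hasDerivAt_of_contDiffOn_two hJo fun s hs =>
    (hJ s hs).1.contDiffWithinAt
  obtain ⟨dρ, dρ', cρ''⟩ := hasDerivAt_of_contDiffOn_two hJo fun s hs =>
    (hJ s hs).2.1.contDiffWithinAt
  obtain ⟨dτ, dτ', -⟩ := hasDerivAt_of_contDiffOn_two hJo fun s hs =>
    (hJ s hs).2.2.1.contDiffWithinAt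
  have G : IsSphereGraph B₂ J v φ a (deriv a) (deriv (deriv a)) ρ (deriv ρ) (deriv (deriv ρ))
      τ (deriv τ) (deriv (deriv τ)) :=
    { isOpen := hB₂o
      isOpen_levels := hJo
      mapsTo := fun z hz => (hB₂ z hz).2
      top_pos := fun z hz => htop z (hB₂B z hz)
      diff_v := fun z hz => (hvat z (hB₂B z hz)).differentiableAt (by simp)
      diff_φ := fun z hz => (hφat z (hB₂B z hz)).differentiableAt (by simp)
      deriv_a := da
      deriv_a' := da'
      deriv_ρ := dρ
      deriv_ρ' := dρ'
      deriv_τ := dτ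
      deriv_τ' := dτ'
      cont_a'' := ca''
      cont_ρ'' := cρ''
      sphere := fun z hz => by
        rw [← (hfact z hz).1, ← (hfact z hz).2.1, hsph z (hB₂B z hz)]
      ρ_pos := fun z hz => by
        rw [← (hfact z hz).2.1]
        exact hr z (hB₂B z hz)
      center_top_pos := fun z hz => by
        rw [← (hfact z hz).1]
        exact hA z (hB₂B z hz)
      ρ_lt := fun z hz => by
        rw [← (hfact z hz).1, ← (hfact z hz).2.1]
        exact hrA z (hB₂B z hz)
      graph := fun z hz => (hfact z hz).2.2
      spacelike := fun z hz => (hB₁ z (hB₂ z hz).1).2.2 }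
  have hB₂n := hB₂o.mem_nhds hxB₂
  rcases G.eventually_center_const hn
    (fun z hz => hmc z (hB₂B z hz) (hB₁ z (hB₂ z hz).1).2.2) hne hxB₂ hγ.continuousAt hγx hvγ with
    ⟨h0, h⟩ | h
  · left
    refine ⟨h0, ?_⟩
    filter_upwards [hvc.eventually h, hB₂n] with z hz hzB
    rw [(hfact z hzB).2.2, hz, (hfact x hxB₂).2.2]
  · right
    filter_upwards [hvc.eventually h, hB₂n] with z hz hzB
    obtain ⟨h1, h2, -⟩ := hfact z hzB
    obtain ⟨h3, h4, -⟩ := hfact x hxB₂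
    rw [h1, h2, h3, h4]
    -- If dφ = 0, then τ'(x - a) = 0, which is impossible since τ' ≠ 0 and the radius is positive.
    refine ⟨hz.1, fun h0 hφ0 => ?_⟩
    have h5 := G.lapse_smul_coordGrad hzB
    have h6 : coordGrad φ z = 0 := by
      ext i
      simp [coordGrad, hφ0]
    rw [h6, smul_zero, zero_eq_neg, smul_eq_zero] at h5
    refine h5.elim (hz.2 h0) fun h7 => ?_
    have := G.ρ_pos z hzB
    rw [← G.sphere z hzB, h7] at this
    simp at this

end

/-! ### The horizontal projection as a chart -/

section

variable {n : ℕ} [NeZero n] {M : Type*} [TopologicalSpace M]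
  [ChartedSpace (EuclideanSpace ℝ (Fin n)) M]

/-- A vertical vector has Lorentzian square -t² ≤ 0, so it cannot be spacelike. -/
theorem IsSpacelikeHypersurface.fst_mfderiv_ne_zero {F : M → Amb n}
    (hF : IsSpacelikeHypersurface F) (p : M) (w : TangentSpace (𝓡 n) p) (hw : w ≠ 0) :
    (mfderiv (𝓡 n) 𝓘(ℝ, Amb n) F p w : Amb n).1 ≠ 0 := by
  intro h
  have := hF.posDef p w hw
  simp only [lorentzMetric, h, inner_zero_left, zero_div, zero_sub] at this
  linarith [mul_self_nonneg (mfderiv (𝓡 n) 𝓘(ℝ, Amb n) F p w : Amb n).2]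

variable [IsManifold (𝓡 n) ∞ M]

/-- The horizontal projection of a spacelike hypersurface is a local diffeomorphism. -/
theorem IsSpacelikeHypersurface.exists_graph_chart {F : M → Amb n}
    (hF : IsSpacelikeHypersurface F) (p : M) :
    ∃ Ψ : OpenPartialHomeomorph M (EuclideanSpace ℝ (Fin n)), p ∈ Ψ.source ∧
      (∀ q ∈ Ψ.source, Ψ q = (F q).1) ∧ ContMDiffOn (𝓡 n) (𝓡 n) ∞ Ψ.symm Ψ.target := by
  set e := chartAt (EuclideanSpace ℝ (Fin n)) p with he
  have hesymm : ContMDiffOn (𝓡 n) (𝓡 n) ∞ e.symm e.target := contMDiffOn_chart_symm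
  set f : EuclideanSpace ℝ (Fin n) → Amb n := fun y => F (e.symm y) with hf
  have hfs : ContDiffOn ℝ ∞ f e.target :=
    contMDiffOn_iff_contDiffOn.1 (hF.smooth.comp_contMDiffOn hesymm)
  set f₁ : EuclideanSpace ℝ (Fin n) → EuclideanSpace ℝ (Fin n) := fun y => (f y).1 with hf₁
  have hf₁s : ContDiffOn ℝ ∞ f₁ e.target := hfs.fst
  have hp : e p ∈ e.target := mem_chart_target _ p
  have hf₁at : ∀ y ∈ e.target, ContDiffAt ℝ ∞ f₁ y := fun y hy =>
    hf₁s.contDiffAt (e.open_target.mem_nhds hy)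
  have hmf : mfderiv (𝓡 n) 𝓘(ℝ, Amb n) F p = fderiv ℝ f (e p) := by
    rw [(hF.smooth.mdifferentiableAt (by simp)).mfderiv]
    simp only [writtenInExtChartAt, mfld_simps]
    rw [fderivWithin_univ]
    rfl
  have hinj : Function.Injective (fderiv ℝ f₁ (e p)) := by
    rw [injective_iff_map_eq_zero]
    intro w hw
    by_contra hw0
    refine hF.fst_mfderiv_ne_zero p w hw0 ?_
    rw [hmf]
    have h1 : HasFDerivAt f (fderiv ℝ f (e p)) (e p) :=
      ((hfs.contDiffAt (e.open_target.mem_nhds hp)).differentiableAt (by simp)).hasFDerivAt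
    have h2 : fderiv ℝ f₁ (e p) = (ContinuousLinearMap.fst ℝ _ _).comp (fderiv ℝ f (e p)) :=
      h1.fst.fderiv
    rw [h2] at hw
    exact hw
  let L : EuclideanSpace ℝ (Fin n) ≃L[ℝ] EuclideanSpace ℝ (Fin n) :=
    (LinearEquiv.ofInjectiveEndo (fderiv ℝ f₁ (e p)).toLinearMap hinj).toContinuousLinearEquiv
  have hL : (L : EuclideanSpace ℝ (Fin n) →L[ℝ] EuclideanSpace ℝ (Fin n)) = fderiv ℝ f₁ (e p) := by
    ext1 z
    rfl
  have hstrict : HasStrictFDerivAt f₁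
      (L : EuclideanSpace ℝ (Fin n) →L[ℝ] EuclideanSpace ℝ (Fin n)) (e p) := by
    rw [hL]
    exact (hf₁at _ hp).hasStrictFDerivAt (by simp)
  -- Invertibility of the derivative on a whole neighborhood makes the local inverse smooth on its
  -- entire target, not only at one point.
  have hinv : ∀ᶠ y in 𝓝 (e p), fderiv ℝ f₁ y ∈ Set.range
      ((↑) : (EuclideanSpace ℝ (Fin n) ≃L[ℝ] EuclideanSpace ℝ (Fin n)) → _) :=
    ((hf₁at _ hp).continuousAt_fderiv (by simp)).eventually
      (by rw [← hL]; exact ContinuousLinearEquiv.nhds L)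
  obtain ⟨S, hS, hSo, hpS⟩ := eventually_nhds_iff.1 ((e.open_target.eventually_mem hp).and hinv)
  set g := (hstrict.toOpenPartialHomeomorph f₁).restrOpen S hSo with hg
  have hgf : ∀ y, g y = f₁ y := fun y => rfl
  have hgS : ∀ y ∈ g.source, y ∈ S := fun y hy => hy.2
  refine ⟨e.trans g, ?_, ?_, ?_⟩
  · rw [OpenPartialHomeomorph.trans_source]
    exact ⟨mem_chart_source _ p, hstrict.mem_toOpenPartialHomeomorph_source, hpS⟩
  · intro q hq
    rw [OpenPartialHomeomorph.trans_source] at hq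
    change (F (e.symm (e q))).1 = _
    rw [e.left_inv hq.1]
  · refine ContMDiffOn.comp (t := e.target) (g := e.symm) (f := g.symm) hesymm ?_ ?_
    · rw [contMDiffOn_iff_contDiffOn]
      intro y hy
      rw [OpenPartialHomeomorph.trans_target] at hy
      have hyS := hgS _ (g.map_target hy.1)
      obtain ⟨hye, L', hL'⟩ := hS _ hyS
      refine (g.contDiffAt_symm (f₀' := L') hy.1 ?_ (hf₁at _ hye)).contDiffWithinAt
      rw [hL']
      exact ((hf₁at _ hye).differentiableAt (by simp)).hasFDerivAt
    · intro y hy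
      rw [OpenPartialHomeomorph.trans_target] at hy
      exact hy.2

end

/-! ### Hyperbolic spheres as Euclidean spheres -/

section Hyperbolic

variable {n : ℕ} [NeZero n]

/-- The Euclidean center of the hyperbolic sphere of center `c` and radius `R`. -/
def euclideanCenter (c : EuclideanSpace ℝ (Fin n)) (R : ℝ) : EuclideanSpace ℝ (Fin n) :=
  c + (c ⊤ * (Real.cosh R - 1)) • EuclideanSpace.single ⊤ 1

theorem euclideanCenter_top (c : EuclideanSpace ℝ (Fin n)) (R : ℝ) :
    euclideanCenter c R ⊤ = c ⊤ * Real.cosh R := by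
  simp [euclideanCenter]
  ring

theorem euclideanCenter_of_ne (c : EuclideanSpace ℝ (Fin n)) (R : ℝ) {i : Fin n} (hi : i ≠ ⊤) :
    euclideanCenter c R i = c i := by
  simp [euclideanCenter, hi]

/-- Hyperbolic spheres are Euclidean spheres. -/
theorem norm_sub_euclideanCenter_sq {c x : EuclideanSpace ℝ (Fin n)} (hc : c ∈ upperHalf n)
    (hx : x ∈ upperHalf n) {R : ℝ} (h : hypDist x c = R) :
    ‖x - euclideanCenter c R‖ ^ 2 = (c ⊤ * Real.sinh R) ^ 2 := by
  have hc0 : 0 < c ⊤ := hc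
  have hx0 : 0 < x ⊤ := hx
  have h1 : ‖x - c‖ / (2 * √(x ⊤ * c ⊤)) = Real.sinh (R / 2) := by
    rw [← h, hypDist, mul_div_cancel_left₀ _ two_ne_zero, Real.sinh_arsinh]
  have h2 : ‖x - c‖ ^ 2 = 4 * (x ⊤ * c ⊤) * Real.sinh (R / 2) ^ 2 := by
    rw [← h1, div_pow, mul_pow, Real.sq_sqrt (mul_pos hx0 hc0).le]
    field_simp
    ring
  have h3 : Real.cosh R = 1 + 2 * Real.sinh (R / 2) ^ 2 := by
    have := Real.cosh_two_mul (R / 2)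
    rw [mul_div_cancel₀ _ (two_ne_zero' ℝ)] at this
    rw [this, Real.cosh_sq]
    ring
  have h4 : Real.sinh R ^ 2 = Real.cosh R ^ 2 - 1 := by rw [Real.cosh_sq]; ring
  rw [euclideanCenter, ← sub_sub, norm_sub_sq_real, h2, inner_smul_right, inner_single_top,
    norm_smul, mul_pow, mul_pow (c ⊤) (Real.sinh R), Real.norm_eq_abs, sq_abs, h4, h3]
  simp
  ring

end Hyperbolic

/-! ### Local rigidity on the hypersurface -/

section Hypersurface

variable {n : ℕ} {M : Type*} [TopologicalSpace M]

/-- The height of the hypersurface over a chart given by horizontal projection. -/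
def chartHeight (F : M → Amb n) (Ψ : OpenPartialHomeomorph M (EuclideanSpace ℝ (Fin n)))
    (x : EuclideanSpace ℝ (Fin n)) : ℝ := (F (Ψ.symm x)).2

variable {F : M → Amb n} {Ψ : OpenPartialHomeomorph M (EuclideanSpace ℝ (Fin n))}

theorem apply_chart_symm (hΨ : ∀ q ∈ Ψ.source, Ψ q = (F q).1) {x : EuclideanSpace ℝ (Fin n)}
    (hx : x ∈ Ψ.target) : F (Ψ.symm x) = (x, chartHeight F Ψ x) := by
  refine Prod.ext ?_ rfl
  rw [← hΨ _ (Ψ.map_target hx), Ψ.right_inv hx]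

variable [NeZero n] [ChartedSpace (EuclideanSpace ℝ (Fin n)) M]

theorem contDiffOn_chartHeight (hF : IsSpacelikeHypersurface F)
    (hs : ContMDiffOn (𝓡 n) (𝓡 n) ∞ Ψ.symm Ψ.target) :
    ContDiffOn ℝ ∞ (chartHeight F Ψ) Ψ.target :=
  (contMDiffOn_iff_contDiffOn.1 (hF.smooth.comp_contMDiffOn hs)).snd

/-- The lift (w, dφ(w)) of w = ∇φ is tangent to the hypersurface, and its Lorentzian square ‖w‖²/xₙ²
- ‖w‖⁴ is positive unless w = 0. -/
theorem spacelike_chartHeight (hF : IsSpacelikeHypersurface F)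
    (hΨ : ∀ q ∈ Ψ.source, Ψ q = (F q).1) (hs : ContMDiffOn (𝓡 n) (𝓡 n) ∞ Ψ.symm Ψ.target)
    {x : EuclideanSpace ℝ (Fin n)} (hx : x ∈ Ψ.target) :
    x ⊤ ^ 2 * ‖coordGrad (chartHeight F Ψ) x‖ ^ 2 < 1 := by
  have hnx := Ψ.open_target.mem_nhds hx
  have hφ : HasFDerivAt (chartHeight F Ψ) (fderiv ℝ (chartHeight F Ψ) x) x :=
    (((contDiffOn_chartHeight hF hs).contDiffAt hnx).differentiableAt (by simp)).hasFDerivAt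
  have h1 : HasMFDerivAt (𝓡 n) 𝓘(ℝ, Amb n) (F ∘ Ψ.symm) x _ :=
    HasMFDerivAt.comp x (hF.smooth.mdifferentiableAt (by simp)).hasMFDerivAt
      ((hs.contMDiffAt hnx).mdifferentiableAt (by simp)).hasMFDerivAt
  have h2 : HasFDerivAt (F ∘ Ψ.symm)
      ((ContinuousLinearMap.id ℝ (EuclideanSpace ℝ (Fin n))).prod
        (fderiv ℝ (chartHeight F Ψ) x)) x := by
    refine ((hasFDerivAt_id x).prodMk hφ).congr_of_eventuallyEq ?_
    filter_upwards [hnx] with z hz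
    exact apply_chart_symm hΨ hz
  have h3 := fun w => DFunLike.congr_fun (hasMFDerivAt_unique h1 h2.hasMFDerivAt) w
  set w := coordGrad (chartHeight F Ψ) x with hw
  by_cases hw0 : w = 0
  · rw [hw0]
    simp
  have hT := h3 w
  set T := (mfderiv (𝓡 n) (𝓡 n) Ψ.symm x) w with hT_def
  have hT0 : T ≠ 0 := by
    intro h0
    have : ((w, fderiv ℝ (chartHeight F Ψ) x w) : Amb n) = 0 := by
      rw [← ContinuousLinearMap.id_apply (R₁ := ℝ) w]
      refine hT.symm.trans ?_
      change mfderiv (𝓡 n) 𝓘(ℝ, Amb n) F (Ψ.symm x) T = 0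
      rw [h0, map_zero]
    exact hw0 (congrArg Prod.fst this)
  have hpos := hF.posDef (Ψ.symm x) T hT0
  have hT' : (mfderiv (𝓡 n) 𝓘(ℝ, Amb n) F (Ψ.symm x) T : Amb n)
      = ((w, fderiv ℝ (chartHeight F Ψ) x w) : Amb n) := hT
  rw [hT', apply_chart_symm hΨ hx] at hpos
  have hx0 : 0 < x ⊤ := by
    have := hF.mem_upperHalf (Ψ.symm x)
    rw [apply_chart_symm hΨ hx] at this
    exact this
  simp only [lorentzMetric, ← inner_coordGrad, ← hw, real_inner_self_eq_norm_sq] at hpos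
  have hw1 : 0 < ‖w‖ ^ 2 := by positivity [norm_pos_iff.2 hw0]
  rw [sub_pos, lt_div_iff₀ (by positivity)] at hpos
  have : ‖w‖ ^ 2 * (x ⊤ ^ 2 * ‖w‖ ^ 2) < ‖w‖ ^ 2 * 1 := by linarith
  exact lt_of_mul_lt_mul_left this hw1.le

theorem isLocalDefiningFunction_graphFun (hF : IsSpacelikeHypersurface F)
    (hΨ : ∀ q ∈ Ψ.source, Ψ q = (F q).1) (hs : ContMDiffOn (𝓡 n) (𝓡 n) ∞ Ψ.symm Ψ.target)
    {x : EuclideanSpace ℝ (Fin n)} (hx : x ∈ Ψ.target) :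
    IsLocalDefiningFunction F (Ψ.symm x) (graphFun (chartHeight F Ψ)) := by
  have hφ := (contDiffOn_chartHeight hF hs).contDiffAt (Ψ.open_target.mem_nhds hx)
  have hFx := apply_chart_symm hΨ hx
  have hd : DifferentiableAt ℝ (chartHeight F Ψ) (F (Ψ.symm x)).1 := by
    rw [hFx]
    exact hφ.differentiableAt (by simp)
  refine ⟨?_, ?_, ?_, ?_⟩
  · rw [hFx]
    exact contDiffAt_snd.sub (ContDiffAt.comp (g := chartHeight F Ψ) (f := Prod.fst) _ hφ
      contDiffAt_fst)
  · filter_upwards [Ψ.open_source.mem_nhds (Ψ.map_target hx)] with q hq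
    rw [graphFun, chartHeight, ← hΨ q hq, Ψ.left_inv hq, sub_self]
  · rw [lorentzMetric_lorentzGrad_graphFun hd, hFx]
    linarith [spacelike_chartHeight hF hΨ hs hx]
  · rw [partialT_graphFun hd]
    exact one_pos

variable [IsManifold (𝓡 n) ∞ M]

/-- Local rigidity at a point of the hypersurface. -/
theorem center_eventually_eq (hn : 2 ≤ n) (hF : IsSpacelikeHypersurface F) {H : ℝ}
    (hcmc : ∀ p : M, HasMeanCurvatureAt F p H) {𝓕 : Setoid M}
    (hfol : IsHorizontalSphereFoliation F 𝓕) (hH : H ≠ 0 ∨ H = 0 ∧ 3 ≤ n)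
    {c : M → EuclideanSpace ℝ (Fin n)} {R : M → ℝ} (hc : ∀ q, c q ∈ upperHalf n)
    (hR : ∀ q, 0 < R q) (hdist : ∀ q, hypDist (F q).1 (c q) = R q)
    (hleaf : ∀ q q', 𝓕 q q' → c q = c q' ∧ R q = R q' ∧ (F q).2 = (F q').2) (p : M) :
    (H = 0 ∧ ∀ᶠ q in 𝓝 p, (F q).2 = (F p).2) ∨
    ∀ᶠ q in 𝓝 p, c q = c p ∧ (H = 0 → ¬ ∀ᶠ q' in 𝓝 q, (F q').2 = (F q).2) := by
  obtain ⟨Ψ, hpΨ, hΨ, hs⟩ := hF.exists_graph_chart p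
  obtain ⟨U, u, hU, hpU, hu, hdu, hlev⟩ := hfol.submersion p
  obtain ⟨x, hx, rfl⟩ : ∃ x ∈ Ψ.target, Ψ.symm x = p := ⟨Ψ p, Ψ.map_source hpΨ, Ψ.left_inv hpΨ⟩
  set B := Ψ.target ∩ Ψ.symm ⁻¹' U with hB_def
  have hB : IsOpen B := Ψ.isOpen_inter_preimage_symm hU
  have hxB : x ∈ B := ⟨hx, hpU⟩
  have hv : ContDiffOn ℝ ∞ (u ∘ Ψ.symm) B :=
    contMDiffOn_iff_contDiffOn.1 (hu.comp (hs.mono Set.inter_subset_left) fun z hz => hz.2)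
  have hφ := (contDiffOn_chartHeight hF hs).mono (s := Ψ.target) (t := B) Set.inter_subset_left
  have hΨp : (F (Ψ.symm x)).1 = x := by rw [apply_chart_symm hΨ hx]
  have hdv : fderiv ℝ (u ∘ Ψ.symm) x ≠ 0 := by
    intro h0
    have h1 : HasFDerivAt (u ∘ Ψ.symm) (0 : EuclideanSpace ℝ (Fin n) →L[ℝ] ℝ)
        (F (Ψ.symm x)).1 := by
      rw [hΨp, ← h0]
      exact ((hv.contDiffAt (hB.mem_nhds hxB)).differentiableAt (by simp)).hasFDerivAt
    have h2 : MDifferentiableAt (𝓡 n) (𝓡 n) (fun q => (F q).1) (Ψ.symm x) :=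
      (contDiff_fst.contMDiff.comp hF.smooth).mdifferentiableAt (n := ∞) (by simp)
    have h3 := HasMFDerivAt.comp (Ψ.symm x) (f := fun q => (F q).1) h1.hasMFDerivAt
      h2.hasMFDerivAt
    -- Near the point, u is its chart expression composed with the horizontal projection, so a
    -- critical point of the expression would be one of u.
    have h4 : u =ᶠ[𝓝 (Ψ.symm x)] (u ∘ Ψ.symm) ∘ fun q => (F q).1 := by
      filter_upwards [Ψ.open_source.mem_nhds hpΨ] with q hq
      rw [Function.comp, Function.comp, ← hΨ q hq, Ψ.left_inv hq]
    refine hdu _ hpU ((h3.congr_of_eventuallyEq h4).mfderiv.trans ?_)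
    ext z
    rfl
  have hup : ∀ z ∈ Ψ.target, z ∈ upperHalf n := fun z hz => by
    have := hF.mem_upperHalf (Ψ.symm z)
    rwa [apply_chart_symm hΨ hz] at this
  have hmain := graph_center_eventually_const hn hB hxB hv hφ hdv (fun z hz => hup z hz.1)
    (spacelike_chartHeight hF hΨ hs hx)
    (A := fun z => euclideanCenter (c (Ψ.symm z)) (R (Ψ.symm z)))
    (r := fun z => (c (Ψ.symm z) ⊤ * Real.sinh (R (Ψ.symm z))) ^ 2)
    (fun z hz w hw hzw => by
      obtain ⟨h1, h2, h3⟩ := hleaf _ _ ((hlev _ hz.2 _ hw.2).2 hzw)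
      rw [h1, h2]
      exact ⟨rfl, rfl, h3⟩)
    (fun z hz => by
      have := hdist (Ψ.symm z)
      rw [apply_chart_symm hΨ hz.1] at this
      exact norm_sub_euclideanCenter_sq (hc _) (hup z hz.1) this)
    (fun z _ => pow_pos (mul_pos (hc _) (Real.sinh_pos_iff.2 (hR _))) 2)
    (fun z _ => by
      rw [euclideanCenter_top]
      exact mul_pos (hc _) (Real.cosh_pos _))
    (fun z _ => by
      have h1 : 0 < c (Ψ.symm z) ⊤ := hc _
      rw [euclideanCenter_top, mul_pow, mul_pow, Real.cosh_sq]
      nlinarith [pow_pos h1 2])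
    (fun z hz _ => by
      have := (hcmc (Ψ.symm z)).2 _ (isLocalDefiningFunction_graphFun hF hΨ hs hz.1)
      rwa [apply_chart_symm hΨ hz.1] at this) hH
  have hΨc : Tendsto Ψ (𝓝 (Ψ.symm x)) (𝓝 x) := by
    have := (Ψ.continuousAt hpΨ).tendsto
    rwa [Ψ.right_inv hx] at this
  have hsrc : ∀ᶠ q in 𝓝 (Ψ.symm x), q ∈ Ψ.source := Ψ.open_source.mem_nhds hpΨ
  rcases hmain with ⟨h0, h⟩ | h
  · left
    refine ⟨h0, ?_⟩
    filter_upwards [hΨc.eventually h, hsrc] with q hq hqs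
    rwa [chartHeight, chartHeight, Ψ.left_inv hqs] at hq
  · right
    filter_upwards [hΨc.eventually h, hsrc] with q hq hqs
    obtain ⟨⟨h1, h2⟩, h3⟩ := hq
    simp only [Ψ.left_inv hqs] at h1 h2
    refine ⟨?_, fun h0 hev => h3 h0 ?_⟩
    · ext i
      by_cases hi : i = ⊤
      -- Since cosh² - sinh² = 1, the invariant aₙ² - ρ equals cₙ², and cₙ > 0 selects the root.
      · simp only [euclideanCenter_top, mul_pow, Real.cosh_sq] at h2
        have h4 : 0 < c q ⊤ := hc q
        have h5 : 0 < c (Ψ.symm x) ⊤ := hc _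
        rw [hi]
        exact (sq_eq_sq₀ h4.le h5.le).1 (by linarith)
      · have := h1 i hi
        rwa [euclideanCenter_of_ne _ _ hi, euclideanCenter_of_ne _ _ hi] at this
    · have hΨs : Tendsto Ψ.symm (𝓝 (Ψ q)) (𝓝 q) := by
        have := (Ψ.symm.continuousAt (Ψ.map_source hqs)).tendsto
        rwa [Ψ.left_inv hqs] at this
      have hconst : chartHeight F Ψ =ᶠ[𝓝 (Ψ q)] fun _ => (F q).2 := hΨs.eventually hev
      rw [hconst.fderiv_eq]
      simp

end Hypersurface

/-! ### Rotational symmetry and globalization -/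

/-- An isometry fixing c preserves the distance to c, hence maps every horizontal sphere about c
into itself; being onto the half-space, it also reaches every point of that sphere. -/
theorem isRotationallySymmetric_of_spheres {n : ℕ} [NeZero n] {c : EuclideanSpace ℝ (Fin n)}
    {S : Set (Amb n)} (hc : c ∈ upperHalf n)
    (h : ∀ y ∈ S, ∃ R t : ℝ, y ∈ horizontalSphere c R t ∧ horizontalSphere c R t ⊆ S) :
    IsRotationallySymmetric c S := by
  intro g hg
  refine Set.Subset.antisymm ?_ fun y hy => ?_
  · rintro _ ⟨y, hy, rfl⟩
    obtain ⟨R, t, ⟨h1, h2, h3⟩, hsub⟩ := h y hy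
    refine hsub ⟨hg.bijOn.mapsTo h1, ?_, h3⟩
    rw [← h2]
    conv_lhs => rw [← hg.fixes]
    exact hg.isometry _ h1 _ hc
  · obtain ⟨R, t, ⟨h1, h2, h3⟩, hsub⟩ := h y hy
    obtain ⟨x, hx, hxy⟩ := hg.bijOn.surjOn h1
    refine ⟨(x, y.2), hsub ⟨hx, ?_, h3⟩, Prod.ext hxy rfl⟩
    rw [← h2, ← hxy, ← hg.isometry x hx c hc, hg.fixes]

end LorentzProduct
end

theorem mainTheorem2 (n : ℕ) [NeZero n] (hn : 2 ≤ n)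
    {M : Type*} [TopologicalSpace M] [T2Space M] [SecondCountableTopology M] [ConnectedSpace M]
    [ChartedSpace (EuclideanSpace ℝ (Fin n)) M] [IsManifold (𝓡 n) ∞ M]
    (F : M → LorentzProduct.Amb n) (hF : LorentzProduct.IsSpacelikeHypersurface F)
    (H : ℝ) (hcmc : ∀ p : M, LorentzProduct.HasMeanCurvatureAt F p H)
    (𝓕 : Setoid M) (hfol : LorentzProduct.IsHorizontalSphereFoliation F 𝓕)
    (hslice : ¬ ∃ t₀ : ℝ, ∀ p : M, (F p).2 = t₀)
    (hH : H ≠ 0 ∨ (H = 0 ∧ 3 ≤ n)) :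
    ∃ c ∈ LorentzProduct.upperHalf n,
      (∀ p : M, ∃ R > 0, ∃ t : ℝ,
        F '' LorentzProduct.leaf 𝓕 p = LorentzProduct.horizontalSphere c R t) ∧
      LorentzProduct.IsRotationallySymmetric c (Set.range F) := by
  classical
  -- Center, radius and height are chosen for each leaf as a set, not for each point, so that they
  -- agree along a leaf by construction. The value 0 for other sets is irrelevant.
  have hex : ∀ S : Set M, ∃ d : EuclideanSpace ℝ (Fin n) × ℝ × ℝ,
      (∃ p, S = LorentzProduct.leaf 𝓕 p) → d.1 ∈ LorentzProduct.upperHalf n ∧ 0 < d.2.1 ∧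
        F '' S = LorentzProduct.horizontalSphere d.1 d.2.1 d.2.2 := by
    intro S
    by_cases hS : ∃ p, S = LorentzProduct.leaf 𝓕 p
    · obtain ⟨p, rfl⟩ := hS
      obtain ⟨c, hc, R, hR, t, hbij⟩ := hfol.sphere p
      exact ⟨(c, R, t), fun _ => ⟨hc, hR, hbij.image_eq⟩⟩
    · exact ⟨0, fun h => absurd h hS⟩
  choose d hd using hex
  have hd' := fun p => hd (LorentzProduct.leaf 𝓕 p) ⟨p, rfl⟩
  have hmem : ∀ p, F p ∈ LorentzProduct.horizontalSphere (d (LorentzProduct.leaf 𝓕 p)).1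
      (d (LorentzProduct.leaf 𝓕 p)).2.1 (d (LorentzProduct.leaf 𝓕 p)).2.2 := fun p => by
    rw [← (hd' p).2.2]
    exact Set.mem_image_of_mem F (𝓕.refl p)
  have hleaf : ∀ q q', 𝓕 q q' → LorentzProduct.leaf 𝓕 q = LorentzProduct.leaf 𝓕 q' :=
    fun q q' h => Set.ext fun z => ⟨fun hz => 𝓕.trans hz h, fun hz => 𝓕.trans hz (𝓕.symm h)⟩
  have hloc := LorentzProduct.center_eventually_eq hn hF hcmc hfol hH (fun q => (hd' q).1)
    (fun q => (hd' q).2.1) (fun q => (hmem q).2.1) (fun q q' h => by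
      refine ⟨by rw [hleaf q q' h], by rw [hleaf q q' h], ?_⟩
      rw [(hmem q).2.2, (hmem q').2.2, hleaf q q' h])
  have hlc : ∀ p, ∀ᶠ q in nhds p, (d (LorentzProduct.leaf 𝓕 q)).1
      = (d (LorentzProduct.leaf 𝓕 p)).1 := by
    -- O consists of the points near which the height is constant. For H = 0 the local dichotomy
    -- makes its complement open: off O, nearby points have no locally constant height either.
    set O : Set M := {p | ∀ᶠ q in nhds p, (F q).2 = (F p).2} with hO
    have hOo : IsOpen O := isOpen_iff_mem_nhds.2 fun p hp => by
      filter_upwards [eventually_eventually_nhds.2 hp, hp] with q hq hqp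
      filter_upwards [hq] with q' hq'
      rw [hq', hqp]
    by_cases hH0 : H = 0
    · have hOc : IsClosed O := ⟨isOpen_iff_mem_nhds.2 fun p hp => by
        filter_upwards [(hloc p).resolve_left fun h => hp h.2] with q hq using hq.2 hH0⟩
      rcases isClopen_iff.1 ⟨hOc, hOo⟩ with h | h
      · intro p
        have hp : p ∉ O := h ▸ Set.notMem_empty p
        exact ((hloc p).resolve_left fun h => hp h.2).mono fun q hq => hq.1
      · have hc : IsLocallyConstant fun q => (F q).2 :=
          IsLocallyConstant.iff_eventually_eq _ |>.2 fun p => by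
            have : p ∈ O := h ▸ Set.mem_univ p
            exact this
        obtain ⟨p₀⟩ := (inferInstance : Nonempty M)
        exact absurd ⟨(F p₀).2, fun p => hc.apply_eq_of_preconnectedSpace p p₀⟩ hslice
    · exact fun p => ((hloc p).resolve_left fun h => hH0 h.1).mono fun q hq => hq.1
  have hconst : IsLocallyConstant fun q => (d (LorentzProduct.leaf 𝓕 q)).1 :=
    (IsLocallyConstant.iff_eventually_eq _).2 hlc
  obtain ⟨p₀⟩ := (inferInstance : Nonempty M)
  have hcenter : ∀ p, (d (LorentzProduct.leaf 𝓕 p)).1 = (d (LorentzProduct.leaf 𝓕 p₀)).1 :=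
    fun p => hconst.apply_eq_of_preconnectedSpace p p₀
  have himg := fun p => (hd' p).2.2
  simp only [hcenter] at himg hmem
  refine ⟨_, (hd' p₀).1, fun p => ⟨_, (hd' p).2.1, _, himg p⟩,
    LorentzProduct.isRotationallySymmetric_of_spheres (hd' p₀).1 ?_⟩
  rintro _ ⟨p, rfl⟩
  exact ⟨_, _, hmem p, by rw [← himg p]; exact Set.image_subset_range _ _⟩
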